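/- Let $R$ be a commutative Noetherian ring, $M$ a finitely generated $R$-module and $I$ an ideal of $R$. For a submodule $N\subseteq M$, the index of reducibility $\mathrm{ir}_M(N)$ is the number of submodules in an irredundant decomposition of $N$ as a finite intersection of irreducible submodules of $M$ (proper submodules that are not the intersection of two strictly larger submodules); this number does not depend on the decomposition, and $\mathrm{ir}_M(M)=0$. Let $\mathrm{bight}_M(I)$ be the maximum of the Krull dimensions $\dim_{R_{\mathfrak p}} M_{\mathfrak p}$ over the minimal elements $\mathfrak p$ of $\mathrm{Ass}_R(M/IM)$. Let $A_M(I)$ be the stable value of $\mathrm{Ass}_R(M/I^nM)$ for $n\gg 0$. If $(R,\mathfrak m)$ is local, put $\ell_M(I)=\dim_{G(I)}\bigl(G_M(I)/\mathfrak m G_M(I)\bigr)$, where $G(I)=\bigoplus_{n\ge 0} I^n/I^{n+1}$ and $G_M(I)=\bigoplus_{n\ge 0} I^nM/I^{n+1}M$; in general, the analytic spread $\ell_M(I)$ is the maximum of $\ell_{M_{\mathfrak m}}(IR_{\mathfrak m})$ over the maximal ideals $\mathfrak m$ of $R$ that contain some $\mathfrak p\in A_M(I)$. (The maximum of the empty set,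 the dimension of the zero module and the degree of the zero polynomial are $-\infty$.) Theorem. There is a polynomial $\mathrm{Ir}_{M,I}\in\mathbb Q[n]$ with $\mathrm{Ir}_{M,I}(n)=\mathrm{ir}_M(I^nM)$ for all sufficiently large $n$. Moreover $$\mathrm{bight}_M(I)-1\le \deg \mathrm{Ir}_{M,I},$$ and, if $\ell_M(I)\neq 0$, $$\deg \mathrm{Ir}_{M,I}\le \ell_M(I)-1 .$$ -/

import Mathlib

open Filter Polynomial

namespace ReducibilityIndex

section Irreducible

variable {R : Type*} [CommRing R] {M : Type*} [AddCommGroup M] [Module R M]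

/-- `s` is an irredundant irreducible decomposition of the submodule `N`: the members of `s` are
irreducible (proper, and not an intersection of two strictly larger submodules), their
intersection is `N`, and no member can be left out. The empty family decomposes `⊤`. -/
structure IsIrredundantIrreducibleDecomposition (N : Submodule R M)
    (s : Finset (Submodule R M)) : Prop where
  infIrred : ∀ Q ∈ s, InfIrred Q
  inf_eq : s.inf id = N
  irredundant : ∀ t, t ⊂ s → t.inf id ≠ N

theorem exists_isIrredundantIrreducibleDecomposition [IsNoetherian R M] (N : Submodule R M) :
    ∃ s, IsIrredundantIrreducibleDecomposition N s := by
  obtain ⟨s, hs, hirr⟩ := exists_infIrred_decomposition N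
  induction s using Finset.strongInduction with
  | H s ih =>
    by_cases h : ∃ t, t ⊂ s ∧ t.inf id = N
    · obtain ⟨t, hts, ht⟩ := h
      exact ih t hts ht fun b hb => hirr (hts.1 hb)
    · exact ⟨s, fun Q hQ => hirr hQ, hs, fun t hts ht => h ⟨t, hts, ht⟩⟩

theorem eq_or_eq_of_inf_eq {a b c d x : Submodule R M} (hx : InfIrred x)
    (hbx : b ⊓ x = a) (hc : c ≤ b) (hd : d ≤ b) (hcd : c ⊓ d = a) : c = a ∨ d = a := by
  have hac : a ≤ c := hcd ▸ inf_le_left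
  have had : a ≤ d := hcd ▸ inf_le_right
  have hax : a ≤ x := hbx ▸ inf_le_right
  have key : (x ⊔ c) ⊓ (x ⊔ d) = x := by
    refine le_antisymm ?_ (le_inf le_sup_left le_sup_left)
    rintro z ⟨hz1, hz2⟩
    obtain ⟨x1, hx1, c1, hc1, rfl⟩ := Submodule.mem_sup.1 hz1
    obtain ⟨x2, hx2, d1, hd1, h⟩ := Submodule.mem_sup.1 hz2
    have e : c1 - d1 = x2 - x1 := by
      rw [sub_eq_sub_iff_add_eq_add, h, add_comm]
    have h1 : c1 - d1 ∈ a := by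
      rw [← hbx]
      exact ⟨b.sub_mem (hc hc1) (hd hd1), e ▸ x.sub_mem hx2 hx1⟩
    have h2 : c1 ∈ d := by simpa using d.add_mem (had h1) hd1
    have h3 : c1 ∈ a := hcd ▸ ⟨hc1, h2⟩
    exact x.add_mem hx1 (hax h3)
  rcases hx.2 key with h | h
  · exact Or.inl (le_antisymm (hbx ▸ le_inf hc (sup_eq_left.1 h)) hac)
  · exact Or.inr (le_antisymm (hbx ▸ le_inf hd (sup_eq_left.1 h)) had)

theorem eq_or_exists_inf_eq {a b x : Submodule R M} (hx : InfIrred x)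
    (hbx : b ⊓ x = a) (t : Finset (Submodule R M)) (ht : b ⊓ t.inf id = a) :
    b = a ∨ ∃ y ∈ t, b ⊓ y = a := by
  classical
  induction t using Finset.induction_on with
  | empty => left; simpa using ht
  | insert y t _ ih =>
    rw [Finset.inf_insert, id, inf_inf_distrib_left] at ht
    rcases eq_or_eq_of_inf_eq hx hbx inf_le_left inf_le_left ht with h | h
    · exact Or.inr ⟨y, Finset.mem_insert_self _ _, h⟩
    · exact (ih h).imp_right fun ⟨z, hz, h⟩ => ⟨z, Finset.mem_insert_of_mem hz, h⟩

theorem exists_subset_card_le {N : Submodule R M} {t : Finset (Submodule R M)}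
    (ht : t.inf id = N) (s : Finset (Submodule R M)) : ∀ u ⊆ t, (∀ Q ∈ s, InfIrred Q) →
    s.inf id ⊓ u.inf id = N → ∃ v ⊆ t, v.inf id = N ∧ v.card ≤ s.card + u.card := by
  classical
  induction s using Finset.induction_on with
  | empty => intro u hu _ h; exact ⟨u, hu, by simpa using h, by simp⟩
  | insert x s hxs ih =>
    intro u hu hirr h
    have hirr' : ∀ Q ∈ s, InfIrred Q := fun Q hQ => hirr Q (Finset.mem_insert_of_mem hQ)
    have hb : (s.inf id ⊓ u.inf id) ⊓ x = N := by
      rw [← h, Finset.inf_insert, id, inf_comm _ x, inf_assoc]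
    rcases eq_or_exists_inf_eq (hirr x (Finset.mem_insert_self _ _)) hb t
      (by rw [ht]; exact inf_eq_right.2 (hb ▸ inf_le_left)) with h' | ⟨y, hy, h'⟩
    · obtain ⟨v, hv, hv1, hv2⟩ := ih u hu hirr' h'
      exact ⟨v, hv, hv1, hv2.trans (by rw [Finset.card_insert_of_notMem hxs]; lia)⟩
    · obtain ⟨v, hv, hv1, hv2⟩ := ih (insert y u) (Finset.insert_subset hy hu) hirr'
        (by rw [← h', Finset.inf_insert, id, inf_comm y, inf_assoc])
      refine ⟨v, hv, hv1, hv2.trans ?_⟩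
      have := Finset.card_insert_le y u
      rw [Finset.card_insert_of_notMem hxs]
      lia

/-- Noether: the number of components does not depend on the decomposition. -/
theorem IsIrredundantIrreducibleDecomposition.card_eq {N : Submodule R M}
    {s t : Finset (Submodule R M)} (hs : IsIrredundantIrreducibleDecomposition N s)
    (ht : IsIrredundantIrreducibleDecomposition N t) : s.card = t.card := by
  have main : ∀ {s t : Finset (Submodule R M)}, IsIrredundantIrreducibleDecomposition N s →
      IsIrredundantIrreducibleDecomposition N t → t.card ≤ s.card := by
    intro s t hs ht
    obtain ⟨v, hv, hv1, hv2⟩ := exists_subset_card_le ht.inf_eq s ∅ (by simp) hs.infIrred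
      (by simpa using hs.inf_eq)
    have : v = t := by
      by_contra hne
      exact ht.irredundant v (hv.ssubset_of_ne hne) hv1
    simpa [this] using hv2
  exact le_antisymm (main ht hs) (main hs ht)

/-- The index of reducibility `ir_M(N)`: the number of components of an (equivalently, by
`indexOfReducibility_eq_card`, of every) irredundant irreducible decomposition of `N`. -/
noncomputable def indexOfReducibility [IsNoetherian R M] (N : Submodule R M) : ℕ :=
  (exists_isIrredundantIrreducibleDecomposition N).choose.card

theorem indexOfReducibility_eq_card [IsNoetherian R M] {N : Submodule R M}
    {s : Finset (Submodule R M)} (hs : IsIrredundantIrreducibleDecomposition N s) :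
    indexOfReducibility N = s.card :=
  (exists_isIrredundantIrreducibleDecomposition N).choose_spec.card_eq hs

end Irreducible

section BigHeight

variable {R : Type*} [CommRing R] (I : Ideal R) (M : Type*) [AddCommGroup M] [Module R M]

/-- The big height `bight_M(I)`: the maximum of the Krull dimensions `dim M_𝔭` over the minimal
elements `𝔭` of `Ass(M/IM)`. It is `⊥` (minus infinity) if there are none, that is, if
`M = IM`. -/
noncomputable def bigHeight : WithBot ℕ∞ :=
  ⨆ (p : PrimeSpectrum R)
    (_ : Minimal (· ∈ associatedPrimes R (M ⧸ (I • ⊤ : Submodule R M))) p.asIdeal),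
    Module.supportDim (Localization p.asIdeal.primeCompl)
      (LocalizedModule p.asIdeal.primeCompl M)

/-- The stable value `A_M(I)` of `Ass(M/IⁿM)` for large `n`: the primes that belong to
`Ass(M/IⁿM)` for all sufficiently large `n`. -/
def stableAssociatedPrimes : Set (Ideal R) :=
  {p | ∀ᶠ n : ℕ in atTop, p ∈ associatedPrimes R (M ⧸ (I ^ n • ⊤ : Submodule R M))}

end BigHeight

section AnalyticSpread

variable {R : Type*} [CommRing R] (I : Ideal R) (M : Type*) [AddCommGroup M] [Module R M]

/-- The associated graded ring `G(I) = ⨁ Iⁿ/Iⁿ⁺¹`, as the quotient of the Rees algebra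
`⨁ Iⁿ tⁿ` by its ideal `⨁ Iⁿ⁺¹ tⁿ` generated by `I`. -/
def AssociatedGradedRing : Type _ :=
  reesAlgebra I ⧸ I.map (algebraMap R (reesAlgebra I))

noncomputable instance : CommRing (AssociatedGradedRing I) :=
  inferInstanceAs (CommRing (reesAlgebra I ⧸ I.map (algebraMap R (reesAlgebra I))))

noncomputable instance : Algebra R (AssociatedGradedRing I) :=
  inferInstanceAs (Algebra R (reesAlgebra I ⧸ I.map (algebraMap R (reesAlgebra I))))

/-- The Rees module `⨁ IⁿM tⁿ` over the Rees algebra: the polynomials `∑ mₙ tⁿ` with `mₙ ∈ IⁿM`. -/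
def ReesModule : Type _ :=
  (I.stableFiltration (⊤ : Submodule R M)).submodule

noncomputable instance : AddCommGroup (ReesModule I M) :=
  inferInstanceAs (AddCommGroup (I.stableFiltration (⊤ : Submodule R M)).submodule)

noncomputable instance : Module (reesAlgebra I) (ReesModule I M) :=
  inferInstanceAs (Module (reesAlgebra I) (I.stableFiltration (⊤ : Submodule R M)).submodule)

/-- The associated graded module `G_M(I) = ⨁ IⁿM/Iⁿ⁺¹M` over `G(I)`, as the quotient of the
Rees module `⨁ IⁿM tⁿ` by its submodule `I · ⨁ IⁿM tⁿ = ⨁ Iⁿ⁺¹M tⁿ`. -/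
def AssociatedGradedModule : Type _ :=
  ReesModule I M ⧸
    (I.map (algebraMap R (reesAlgebra I)) • ⊤ : Submodule (reesAlgebra I) (ReesModule I M))

noncomputable instance : AddCommGroup (AssociatedGradedModule I M) :=
  inferInstanceAs (AddCommGroup (ReesModule I M ⧸
    (I.map (algebraMap R (reesAlgebra I)) • ⊤ : Submodule (reesAlgebra I) (ReesModule I M))))

noncomputable instance : Module (AssociatedGradedRing I) (AssociatedGradedModule I M) :=
  inferInstanceAs (Module (reesAlgebra I ⧸ I.map (algebraMap R (reesAlgebra I))) (ReesModule I M ⧸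
    (I.map (algebraMap R (reesAlgebra I)) • ⊤ : Submodule (reesAlgebra I) (ReesModule I M))))

/-- The analytic spread over a local ring `(R, 𝔪)`: the Krull dimension over `G(I)` of
`G_M(I)/𝔪 G_M(I)`. -/
noncomputable def localAnalyticSpread [IsLocalRing R] : WithBot ℕ∞ :=
  Module.supportDim (AssociatedGradedRing I)
    (AssociatedGradedModule I M ⧸
      ((IsLocalRing.maximalIdeal R).map (algebraMap R (AssociatedGradedRing I)) • ⊤ :
        Submodule (AssociatedGradedRing I) (AssociatedGradedModule I M)))

/-- The analytic spread `ℓ_M(I)`: the maximum of the analytic spreads of `I R_𝔪` on `M_𝔪` over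
the maximal ideals `𝔪` that contain some prime of `A_M(I)`. It is `⊥` (minus infinity) if there
are none, that is, if `M = IM`. -/
noncomputable def analyticSpread : WithBot ℕ∞ :=
  ⨆ (m : MaximalSpectrum R) (_ : ∃ p ∈ stableAssociatedPrimes I M, p ≤ m.asIdeal),
    localAnalyticSpread (I.map (algebraMap R (Localization.AtPrime m.asIdeal)))
      (LocalizedModule m.asIdeal.primeCompl M)

end AnalyticSpread

end ReducibilityIndex

/-! The index of reducibility is a local invariant. For each irreducible component `Q` the module
`M/Q` has a single associated prime, and the components of `K` that belong to `p` correspond to a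
basis of the socle of `(M/K)_p`; hence `ir_M(K)` is the sum of these socle lengths
(`indexOfReducibility_eq_sum_socleLengthAt`). All the sets `Ass(M/IⁿM)` lie in one finite set
(`exists_finset_associatedPrimes`), so it suffices to treat the socle of `N/IⁿN` over a Noetherian
local ring `(A, 𝔪)`.

By Artin-Rees, `Iⁿ⁺ᶜN : 𝔪 = Iⁿ(IᶜN : 𝔪) + (0 : 𝔪)`. Modulo `Iⁿ⁺ᶜN` the first summand is the `n`-th
piece of a finitely generated graded module over the Rees algebra, so Hilbert's theorem applies; the
second adds an eventually constant amount (`exists_eventuallyEval_socle`). Socle lengths are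
nonnegative, so leading terms cannot cancel and the degree of the sum is the maximum of the degrees.

Lower bound: at a minimal `p` of `Ass(M/IM)` some `𝔪ˢ` maps `N` into `IN`. Then the length of
`IᵏN/Iᵏ⁺¹N` is at most a constant times the socle length of `N/Iᵏ⁺¹N`. Summation over `k < n` bounds
the growth of the length of `N/IⁿN`, and with it `dim N` (`supportDim_le_of_length_le`).

Upper bound: Artin-Rees over the Rees algebra bounds the socle length, up to additive and
multiplicative constants, by the number of generators of `IⁿN`, which may be computed at a maximal
ideal above `p`. Noether normalization of the fibre ring shows that these numbers, summed over `i <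
n`, grow with degree at most the analytic spread (`exists_sum_spanFinrank_le_localAnalyticSpread`).
The additive constant sums to a linear term, which is harmless once the spread is at least 1. -/

namespace ReducibilityIndex

/-! ### Lengths of subquotients. -/

section RelativeLength

variable {A : Type*} [CommRing A] {N N' : Type*} [AddCommGroup N] [Module A N]
  [AddCommGroup N'] [Module A N']

/-- The length of `J / (K ∩ J)`. -/
noncomputable def relativeLength (K J : Submodule A N) : ℕ∞ :=
  Module.length A (J ⧸ K.submoduleOf J)

theorem relativeLength_eq_length_range {K J : Submodule A N} (g : J →ₗ[A] N')
    (hg : LinearMap.ker g = K.submoduleOf J) :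
    relativeLength K J = Module.length A (LinearMap.range g) := by
  unfold relativeLength
  rw [← hg]
  exact g.quotKerEquivRange.length_eq

theorem relativeLength_eq_length_map (K J : Submodule A N) :
    relativeLength K J = Module.length A (J.map K.mkQ) := by
  rw [relativeLength_eq_length_range (K.mkQ ∘ₗ J.subtype), LinearMap.range_comp,
    Submodule.range_subtype]
  rw [LinearMap.ker_comp, Submodule.ker_mkQ]; rfl

theorem relativeLength_mono {K J J' : Submodule A N} (h : J ≤ J') :
    relativeLength K J ≤ relativeLength K J' := by
  rw [relativeLength_eq_length_map, relativeLength_eq_length_map]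
  exact Module.length_le_of_injective (Submodule.inclusion (Submodule.map_mono h))
    (Submodule.inclusion_injective _)

theorem relativeLength_anti {K K' J : Submodule A N} (h : K ≤ K') :
    relativeLength K' J ≤ relativeLength K J :=
  Module.length_le_of_surjective (Submodule.factor (Submodule.comap_mono h))
    (Submodule.factor_surjective _)

theorem relativeLength_sup (K J : Submodule A N) :
    relativeLength K (J ⊔ K) = relativeLength K J := by
  rw [relativeLength_eq_length_map, relativeLength_eq_length_map, Submodule.map_sup]
  have h : K.map K.mkQ = ⊥ := by simp
  rw [h, sup_bot_eq]

/-- Both sides are the length of the image of `J` in `N' ⧸ K` under `K.mkQ ∘ₗ f`. -/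
theorem relativeLength_comap {K : Submodule A N'} (f : N →ₗ[A] N') (J : Submodule A N) :
    relativeLength (J ⊓ K.comap f) J = relativeLength K (J.map f ⊔ K) := by
  rw [relativeLength_sup, relativeLength_eq_length_map K,
    relativeLength_eq_length_range (K.mkQ ∘ₗ f ∘ₗ J.subtype), LinearMap.range_comp,
    LinearMap.range_comp, Submodule.range_subtype]
  rw [LinearMap.ker_comp, Submodule.ker_mkQ]
  ext x
  simp [Submodule.submoduleOf]

theorem relativeLength_eq_add {K L J : Submodule A N} (h : K ≤ L) (h' : L ≤ J) :
    relativeLength K J = relativeLength K L + relativeLength L J := by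
  rw [relativeLength_eq_length_map, relativeLength_eq_length_map,
    relativeLength_eq_length_map L J]
  let φ := (Submodule.factor h).domRestrict (J.map K.mkQ)
  have hφ : LinearMap.range φ = J.map L.mkQ := by
    rw [LinearMap.range_domRestrict, ← Submodule.map_comp]
    rfl
  rw [← hφ]
  refine Module.length_eq_add_of_exact (Submodule.inclusion (Submodule.map_mono h'))
    φ.rangeRestrict (Submodule.inclusion_injective _) φ.surjective_rangeRestrict ?_
  rw [LinearMap.exact_iff, LinearMap.ker_rangeRestrict, Submodule.range_inclusion]
  ext ⟨x, hx⟩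
  obtain ⟨y, hy, rfl⟩ := hx
  have e : φ ⟨K.mkQ y, _, hy, rfl⟩ = L.mkQ y := rfl
  rw [LinearMap.mem_ker, e, Submodule.mkQ_apply, Submodule.Quotient.mk_eq_zero]
  simp only [Submodule.mem_comap, Submodule.subtype_apply, Submodule.mem_map, Submodule.mkQ_apply]
  refine ⟨fun hy => ⟨y, hy, rfl⟩, fun ⟨z, hz, e⟩ => ?_⟩
  rw [Submodule.Quotient.eq] at e
  simpa using L.sub_mem hz (h e)

theorem relativeLength_eq_zero_iff {K J : Submodule A N} : relativeLength K J = 0 ↔ J ≤ K := by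
  rw [relativeLength, Module.length_eq_zero_iff, Submodule.Quotient.subsingleton_iff,
    Submodule.submoduleOf_eq_top]

end RelativeLength

/-! ### Functions that are eventually polynomial, and their degrees. -/

section EventuallyPolynomial

/-- `f n` is finite and equal to `P n` for large `n`. -/
def EventuallyEval (P : ℚ[X]) (f : ℕ → ℕ∞) : Prop :=
  ∀ᶠ n : ℕ in atTop, ∃ k : ℕ, f n = k ∧ P.eval (n : ℚ) = k

theorem exists_eval_add_one_sub_eval (g : ℚ[X]) :
    ∃ S : ℚ[X], ∀ x : ℚ, S.eval (x + 1) - S.eval x = g.eval x := by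
  induction g using Polynomial.induction_on' with
  | add p q hp hq =>
    obtain ⟨S, hS⟩ := hp
    obtain ⟨T, hT⟩ := hq
    refine ⟨S + T, fun x => ?_⟩
    rw [eval_add, eval_add, eval_add, ← hS, ← hT]
    ring
  | monomial n a =>
    -- Bernoulli polynomials satisfy `B_{n+1}(x+1) - B_{n+1}(x) = (n+1) xⁿ`.
    refine ⟨C (a / (n + 1)) * Polynomial.bernoulli (n + 1), fun x => ?_⟩
    have : (n : ℚ) + 1 ≠ 0 := by positivity
    rw [add_comm x 1, eval_mul, eval_mul, Polynomial.bernoulli_eval_one_add]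
    simp only [eval_C, eval_monomial, Nat.add_sub_cancel, Nat.cast_add, Nat.cast_one]
    field_simp
    ring

theorem EventuallyEval.add {P Q : ℚ[X]} {f g : ℕ → ℕ∞} (hf : EventuallyEval P f)
    (hg : EventuallyEval Q g) : EventuallyEval (P + Q) (fun n => f n + g n) := by
  filter_upwards [hf, hg] with n ⟨k, hk, hk'⟩ ⟨l, hl, hl'⟩
  exact ⟨k + l, by simp [hk, hl], by simp [hk', hl']⟩

theorem EventuallyEval.congr {P : ℚ[X]} {f g : ℕ → ℕ∞} (hf : EventuallyEval P f)
    (h : ∀ᶠ n in atTop, f n = g n) : EventuallyEval P g := by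
  filter_upwards [hf, h] with n ⟨k, hk, hk'⟩ h
  exact ⟨k, by rw [← h, hk], hk'⟩

theorem EventuallyEval.sum {ι : Type*} {P : ι → ℚ[X]} {f : ι → ℕ → ℕ∞} (s : Finset ι)
    (h : ∀ i ∈ s, EventuallyEval (P i) (f i)) :
    EventuallyEval (∑ i ∈ s, P i) (fun n => ∑ i ∈ s, f i n) := by
  classical
  induction s using Finset.induction_on with
  | empty => exact Eventually.of_forall fun n => ⟨0, by simp, by simp⟩
  | insert a s ha ih =>
    simp only [Finset.sum_insert ha]
    exact (h a (Finset.mem_insert_self _ _)).add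
      (ih fun i hi => h i (Finset.mem_insert_of_mem hi))

theorem EventuallyEval.shift {P : ℚ[X]} {f : ℕ → ℕ∞} (c : ℕ)
    (h : EventuallyEval P fun n => f (n + c)) :
    EventuallyEval (P.comp (X - Polynomial.C (c : ℚ))) f := by
  rw [EventuallyEval, eventually_atTop] at *
  obtain ⟨n₀, h⟩ := h
  refine ⟨n₀ + c, fun n hn => ?_⟩
  obtain ⟨k, hk, hk'⟩ := h (n - c) (by lia)
  refine ⟨k, by rwa [Nat.sub_add_cancel (by lia)] at hk, ?_⟩
  rw [← hk', eval_comp, Nat.cast_sub (by lia)]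
  simp

/-- Discrete integration: the difference `f (n + 1) - f n` is eventually `Q - P`, so `f` is a
discrete antiderivative of it plus a constant. The additive form avoids subtraction in `ℕ∞`. -/
theorem exists_eventuallyEval_of_add_eq {f a b : ℕ → ℕ∞} {P Q : ℚ[X]} (ha : EventuallyEval P a)
    (hb : EventuallyEval Q b) (hf : ∀ᶠ n in atTop, f n ≠ ⊤)
    (h : ∀ᶠ n in atTop, f (n + 1) + a n = f n + b n) : ∃ S, EventuallyEval S f := by
  obtain ⟨S, hS⟩ := exists_eval_add_one_sub_eval (Q - P)
  obtain ⟨n₀, h₀⟩ := eventually_atTop.1 (ha.and (hb.and (hf.and h)))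
  have key : ∀ n ≥ n₀, ((f (n + 1)).toNat : ℚ) - (f n).toNat = S.eval ((n : ℚ) + 1) - S.eval (n : ℚ) := by
    intro n hn
    obtain ⟨⟨k, hk, hk'⟩, ⟨l, hl, hl'⟩, hn1, hn2⟩ := h₀ n hn
    have hn3 := (h₀ (n + 1) (by lia)).2.2.1
    lift f n to ℕ using hn1 with u hu
    lift f (n + 1) to ℕ using hn3 with v hv
    rw [hk, hl] at hn2
    rw [hS, eval_sub, hk', hl', ENat.toNat_natCast, ENat.toNat_natCast]
    have : (v : ℚ) + k = u + l := by exact_mod_cast hn2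
    linarith
  refine ⟨S + Polynomial.C ((f n₀).toNat - S.eval (n₀ : ℚ)), eventually_atTop.2 ⟨n₀, fun n hn => ?_⟩⟩
  refine ⟨(f n).toNat, (ENat.natCast_toNat (h₀ n hn).2.2.1).symm, ?_⟩
  induction n, hn using Nat.le_induction with
  | base => simp
  | succ n hn ih =>
    have := key n hn
    rw [eval_add, eval_C] at ih ⊢
    push_cast
    linarith

theorem exists_eventuallyEval_of_monotone {f : ℕ → ℕ∞} (h : Monotone f) {b : ℕ∞} (hb : b ≠ ⊤)
    (h' : ∀ n, f n ≤ b) : ∃ k : ℕ, EventuallyEval (C (k : ℚ)) f := by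
  lift b to ℕ using hb
  have hf : ∀ n, f n ≠ ⊤ := fun n => ne_top_of_le_ne_top (ENat.natCast_ne_top _) (h' n)
  have hex : ∃ k : ℕ, ∀ n, f n ≤ k := ⟨b, h'⟩
  classical
  obtain ⟨n₀, h₀⟩ : ∃ n, f n = Nat.find hex := by
    by_contra! hne
    rcases hk : Nat.find hex with _ | k
    · exact hne 0 (le_antisymm (Nat.find_spec hex 0) (by simp [hk]))
    · refine Nat.find_min hex (m := k) (by lia) fun n => ?_
      have := (Nat.find_spec hex n).lt_of_ne (hne n)
      rw [hk] at this
      exact ENat.lt_natCast_add_one_iff.1 this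
  refine ⟨Nat.find hex, eventually_atTop.2 ⟨n₀, fun n hn => ⟨Nat.find hex, ?_, by simp⟩⟩⟩
  exact le_antisymm (Nat.find_spec hex n) (h₀ ▸ h hn)

theorem norm_natCast_rat (n : ℕ) : ‖(n : ℚ)‖ = n := by
  rw [← Rat.norm_cast_real]
  simp

theorem EventuallyEval.exists_le_mul_pow {P : ℚ[X]} {f : ℕ → ℕ∞} (h : EventuallyEval P f) :
    ∃ C : ℕ, ∀ᶠ n : ℕ in atTop, f n ≤ C * (n + 1) ^ P.natDegree := by
  have h1 : P.degree ≤ (X ^ P.natDegree : ℚ[X]).degree := by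
    rw [degree_X_pow]
    exact degree_le_natDegree
  obtain ⟨c, hc⟩ := (isBigO_atTop_of_degree_le _ _ h1).bound
  obtain ⟨C, hC⟩ := exists_nat_ge c
  refine ⟨C, ?_⟩
  filter_upwards [h, tendsto_natCast_atTop_atTop.eventually hc] with n ⟨k, hk, hk'⟩ hn
  rw [hk', norm_natCast_rat, eval_pow, eval_X, norm_pow, norm_natCast_rat] at hn
  rw [hk]
  have : (k : ℝ) ≤ (C * (n + 1) ^ P.natDegree : ℕ) := by
    push_cast
    refine hn.trans ?_
    gcongr
    linarith
  exact_mod_cast this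

/-- If the sums of the values of a polynomial grow at most like `n ^ L`, then its degree is less
than `L`. -/
theorem EventuallyEval.degree_lt_of_sum_le {P : ℚ[X]} {f : ℕ → ℕ∞} (h : EventuallyEval P f)
    {L C : ℕ} (hs : ∀ n, ∑ k ∈ Finset.range n, f k ≤ C * (n + 1) ^ L) :
    P.degree < L := by
  by_contra! hdeg
  have h1 : (X ^ L : ℚ[X]).degree ≤ P.degree := by rwa [degree_X_pow]
  obtain ⟨c, hc⟩ := (isBigO_atTop_of_degree_le _ _ h1).bound
  obtain ⟨D, hD⟩ := exists_nat_ge c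
  obtain ⟨n₀, h₀⟩ := eventually_atTop.1 (h.and (tendsto_natCast_atTop_atTop.eventually hc))
  have key : ∀ n ≥ n₀, ((n ^ L : ℕ) : ℕ∞) ≤ D * f n := by
    intro n hn
    obtain ⟨⟨k, hk, hk'⟩, hn⟩ := h₀ n hn
    rw [hk', norm_natCast_rat, eval_pow, eval_X, norm_pow, norm_natCast_rat] at hn
    rw [hk]
    have : ((n ^ L : ℕ) : ℝ) ≤ (D * k : ℕ) := by
      push_cast
      exact hn.trans (by gcongr)
    exact_mod_cast this
  -- If `deg P ≥ L`, then `n ^ L` is at most a constant times `f n`. Summing over the `n` integers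
  -- in `[n, 2n)` gives `n ^ (L + 1)` below a multiple of `n ^ L`, so `n` is bounded.
  have main : ∀ n ≥ n₀, n ≠ 0 → n ≤ D * C * 3 ^ L := by
    intro n hn hn'
    have h2 : ((n * n ^ L : ℕ) : ℕ∞) ≤ ((D * (C * (2 * n + 1) ^ L) : ℕ) : ℕ∞) :=
      calc ((n * n ^ L : ℕ) : ℕ∞) = ∑ k ∈ Finset.Ico n (2 * n), ((n ^ L : ℕ) : ℕ∞) := by
            rw [Finset.sum_const, Nat.card_Ico, nsmul_eq_mul, ← Nat.cast_mul]
            congr 2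
            lia
        _ ≤ ∑ k ∈ Finset.Ico n (2 * n), D * f k := by
            refine Finset.sum_le_sum fun k hk => ?_
            have hk := (Finset.mem_Ico.1 hk).1
            refine le_trans ?_ (key k (hn.trans hk))
            exact_mod_cast Nat.pow_le_pow_left hk L
        _ ≤ ∑ k ∈ Finset.range (2 * n), D * f k := by
            refine Finset.sum_le_sum_of_subset fun k hk => ?_
            exact Finset.mem_range.2 (Finset.mem_Ico.1 hk).2
        _ ≤ _ := by
            rw [← Finset.mul_sum]
            push_cast
            gcongr
            exact_mod_cast hs (2 * n)
    have h3 : n * n ^ L ≤ D * C * 3 ^ L * n ^ L := by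
      have h4 : n * n ^ L ≤ D * (C * (2 * n + 1) ^ L) := by exact_mod_cast h2
      calc n * n ^ L ≤ D * (C * (2 * n + 1) ^ L) := h4
        _ ≤ D * (C * (3 * n) ^ L) := by gcongr; lia
        _ = _ := by ring
    exact Nat.le_of_mul_le_mul_right h3 (by positivity)
  have := main (n₀ + D * C * 3 ^ L + 1) (by lia) (by lia)
  lia

theorem EventuallyEval.degree_le {P Q : ℚ[X]} {f g : ℕ → ℕ∞} (hf : EventuallyEval P f)
    (hg : EventuallyEval Q g) (h : ∀ᶠ n in atTop, f n ≤ g n) : P.degree ≤ Q.degree := by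
  by_contra! hdeg
  have hP : P ≠ 0 := by
    rintro rfl
    simp at hdeg
  -- Eventually `|Q| ≤ |P| / 2`; with `P ≤ Q` this forces `P(n) = 0` at some large `n` that is not a
  -- root.
  have h1 := (isLittleO_atTop_of_degree_lt _ _ hdeg).def (show (0 : ℝ) < 1 / 2 by norm_num)
  have h2 := tendsto_natCast_atTop_atTop.eventually (h1.and (eventually_atTop_not_isRoot P hP))
  obtain ⟨n, ⟨⟨k, hk, hk'⟩, ⟨l, hl, hl'⟩⟩, hn, h3, h4⟩ := ((hf.and hg).and (h.and h2)).exists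
  rw [hk', hl', norm_natCast_rat, norm_natCast_rat] at h3
  rw [hk, hl] at hn
  have h5 : (k : ℝ) ≤ l := by exact_mod_cast hn
  have h6 : (k : ℝ) = 0 := by
    have : (0 : ℝ) ≤ k := by positivity
    linarith
  apply h4
  rw [IsRoot, hk']
  exact_mod_cast h6

theorem EventuallyEval.eventually_ne_zero {P : ℚ[X]} {f : ℕ → ℕ∞} (hf : EventuallyEval P f)
    (hP : P ≠ 0) : ∀ᶠ n in atTop, f n ≠ 0 := by
  filter_upwards [hf, tendsto_natCast_atTop_atTop.eventually (eventually_atTop_not_isRoot P hP)]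
    with n ⟨k, hk, hk'⟩ h h0
  apply h
  rw [IsRoot, hk']
  rw [hk] at h0
  exact_mod_cast h0

theorem EventuallyEval.ne_zero {P : ℚ[X]} {f : ℕ → ℕ∞} (hf : EventuallyEval P f)
    (h : ∀ᶠ n in atTop, f n ≠ 0) : P ≠ 0 := by
  rintro rfl
  obtain ⟨n, ⟨k, hk, hk'⟩, h⟩ := (hf.and h).exists
  rw [eval_zero] at hk'
  apply h
  rw [hk]
  exact_mod_cast hk'.symm

end EventuallyPolynomial

/-! ### Hilbert functions of quotients of filtrations. -/

section HilbertFunction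

variable {A : Type*} [CommRing A] {N : Type*} [AddCommGroup N] [Module A N] {I : Ideal A}

/-- The graded module `⨁ Jₙ/Kₙ` is Noetherian over the polynomial ring with variables `S`. -/
def NoetherianPair (S : Finset A) (J K : I.Filtration N) : Prop :=
  ∀ L : I.Filtration N, K ≤ L → L ≤ J →
    ∀ᶠ n in atTop, L.N (n + 1) ≤ Ideal.span (S : Set A) • L.N n ⊔ K.N (n + 1)

/-- The kernel of multiplication by `x : Jₙ/Kₙ → Jₙ₊₁/Kₙ₊₁`. -/
def kernelFiltration (x : A) (J K : I.Filtration N) : I.Filtration N where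
  N n := J.N n ⊓ (K.N (n + 1)).comap (LinearMap.lsmul A N x)
  mono n := inf_le_inf (J.mono n) (Submodule.comap_mono (K.mono _))
  smul_le n := by
    rw [Submodule.smul_le]
    rintro a ha y ⟨hy, hy'⟩
    refine ⟨J.smul_le n (Submodule.smul_mem_smul ha hy), ?_⟩
    simp only [SetLike.mem_coe, Submodule.mem_comap, LinearMap.lsmul_apply] at hy' ⊢
    rw [smul_comm]
    exact K.smul_le _ (Submodule.smul_mem_smul ha hy')

/-- The image of `x : Jₙ → Jₙ₊₁/Kₙ₊₁`, as a submodule of `Jₙ₊₁` containing `Kₙ₊₁`. -/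
def imageFiltration (x : A) (J K : I.Filtration N) : I.Filtration N where
  N n := (J.N n).map (LinearMap.lsmul A N x) ⊔ K.N (n + 1)
  mono n := sup_le_sup (Submodule.map_mono (J.mono _)) (K.mono _)
  smul_le n := by
    rw [Submodule.smul_sup, ← Submodule.map_smul'']
    exact sup_le_sup (Submodule.map_mono (J.smul_le _)) (K.smul_le _)

def shiftFiltration (c : ℕ) (J : I.Filtration N) : I.Filtration N where
  N n := J.N (n + c)
  mono n := by
    rw [add_right_comm]
    exact J.mono _
  smul_le n := by
    rw [add_right_comm]
    exact J.smul_le _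

/-- Hilbert-Serre induction on the number of variables. Multiplication by `x` from `Jₙ/Kₙ` to
`Jₙ₊₁/Kₙ₊₁` has kernel and cokernel killed by `x`, hence Noetherian over the remaining variables,
and their lengths determine the difference of consecutive lengths. Without variables, almost all
pieces vanish. -/
theorem NoetherianPair.exists_eventuallyEval (S : Finset A) (hS : ∀ x ∈ S, x ∈ I) :
    ∀ (J K : I.Filtration N), K ≤ J → NoetherianPair S J K →
    (∀ n, relativeLength (K.N n) (J.N n) ≠ ⊤) →
    ∃ P : ℚ[X], EventuallyEval P fun n => relativeLength (K.N n) (J.N n) := by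
  classical
  induction S using Finset.induction_on with
  | empty =>
    intro J K hKJ h _
    refine ⟨0, ?_⟩
    obtain ⟨n₀, h⟩ := eventually_atTop.1 (h J hKJ le_rfl)
    refine eventually_atTop.2 ⟨n₀ + 1, fun n hn => ⟨0, ?_, by simp⟩⟩
    obtain ⟨n, rfl⟩ : ∃ m, n = m + 1 := ⟨n - 1, by lia⟩
    have := h n (by lia)
    rw [Nat.cast_zero, relativeLength_eq_zero_iff]
    simpa using this
  | insert x S _ ih =>
    intro J K hKJ h hfin
    have hx : x ∈ I := hS x (Finset.mem_insert_self _ _)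
    specialize ih fun y hy => hS y (Finset.mem_insert_of_mem hy)
    have hK : K ≤ kernelFiltration x J K := fun n =>
      le_inf (hKJ n) fun y hy => K.smul_le n (Submodule.smul_mem_smul hx hy)
    have hJ : imageFiltration x J K ≤ shiftFiltration 1 J := fun n => sup_le
      (Submodule.map_le_iff_le_comap.2 fun y hy => J.smul_le n (Submodule.smul_mem_smul hx hy))
      (hKJ _)
    have hspan : Ideal.span ((insert x S : Finset A) : Set A) =
        Ideal.span {x} ⊔ Ideal.span (S : Set A) := by
      rw [Finset.coe_insert, Ideal.span_insert]
    have h1 : NoetherianPair S (kernelFiltration x J K) K := by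
      intro L hL hL'
      have hLJ : L ≤ J := hL'.trans fun n => inf_le_left
      filter_upwards [h L hL hLJ] with n hn
      refine hn.trans ?_
      rw [hspan, Submodule.sup_smul, sup_assoc]
      refine sup_le ?_ le_rfl
      refine le_trans ?_ le_sup_right
      rw [Submodule.ideal_span_singleton_smul]
      rintro _ ⟨y, hy, rfl⟩
      exact (hL' n hy).2
    have h2 : NoetherianPair S (shiftFiltration 1 J) (imageFiltration x J K) := by
      intro L hL hL'
      have hKL : ∀ n, K.N (n + 1) ≤ L.N n := fun n => le_sup_right.trans (hL n)
      -- `L` lives on the shifted module; moving it back by one degree requires a term in degree 0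
      -- between `K.N 0` and `J.N 0` that contains `L.N 0`.
      let L' : I.Filtration N :=
        { N := fun n => n.casesOn (K.N 0 ⊔ L.N 0) (fun n => L.N n)
          mono := fun n => by
            cases n with
            | zero => exact le_sup_right
            | succ n => exact L.mono n
          smul_le := fun n => by
            cases n with
            | zero =>
              change I • (K.N 0 ⊔ L.N 0) ≤ L.N 0
              rw [Submodule.smul_sup]
              exact sup_le ((K.smul_le 0).trans (hKL 0)) ((L.smul_le 0).trans (L.mono 0))
            | succ n => exact L.smul_le n }
      have h3 : K ≤ L' := by
        rintro (_ | n)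
        · exact le_sup_left
        · exact hKL n
      have h4 : L' ≤ J := by
        rintro (_ | n)
        · exact sup_le (hKJ 0) ((hL' 0).trans (J.mono 0))
        · exact hL' n
      obtain ⟨n₀, h5⟩ := eventually_atTop.1 (h L' h3 h4)
      refine eventually_atTop.2 ⟨n₀, fun n hn => (h5 (n + 1) (by lia)).trans ?_⟩
      rw [hspan, Submodule.sup_smul]
      refine sup_le (sup_le ?_ le_sup_left) (le_trans ?_ le_sup_right)
      · refine le_trans ?_ le_sup_right
        rw [Submodule.ideal_span_singleton_smul]
        refine le_trans ?_ le_sup_left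
        rintro _ ⟨y, hy, rfl⟩
        exact ⟨y, hL' n hy, rfl⟩
      · exact le_sup_right
    have e1 : ∀ n, relativeLength (K.N n) (J.N n) =
        relativeLength (K.N n) ((kernelFiltration x J K).N n) +
        relativeLength ((kernelFiltration x J K).N n) (J.N n) := fun n =>
      relativeLength_eq_add (hK n) inf_le_left
    have e2 : ∀ n, relativeLength (K.N (n + 1)) (J.N (n + 1)) =
        relativeLength ((kernelFiltration x J K).N n) (J.N n) +
        relativeLength ((imageFiltration x J K).N n) (J.N (n + 1)) := fun n => by
      rw [relativeLength_eq_add (J := J.N (n + 1)) (L := (imageFiltration x J K).N n) le_sup_right (hJ n)]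
      congr 1
      exact (relativeLength_comap _ _).symm
    obtain ⟨P, hP⟩ := ih _ _ hK h1 fun n => ne_top_of_le_ne_top (hfin n) (e1 n ▸ le_self_add)
    obtain ⟨Q, hQ⟩ := ih _ _ hJ h2 fun n =>
      ne_top_of_le_ne_top (hfin (n + 1)) (e2 n ▸ le_add_self)
    refine exists_eventuallyEval_of_add_eq hP hQ (Eventually.of_forall hfin)
      (Eventually.of_forall fun n => ?_)
    change _ = _ + relativeLength _ (J.N (n + 1))
    rw [e2, e1 n]
    ring

/-- Every filtration below a stable one is stable, so `Lₙ₊₁ = I Lₙ` for large `n`; the variables are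
generators of `I`. -/
theorem exists_noetherianPair [IsNoetherianRing A] [Module.Finite A N] {J : I.Filtration N}
    (hJ : J.Stable) : ∃ S : Finset A, (∀ x ∈ S, x ∈ I) ∧ ∀ K, NoetherianPair S J K := by
  obtain ⟨S, hS⟩ := IsNoetherian.noetherian I
  refine ⟨S, fun x hx => hS ▸ Submodule.subset_span hx, fun K L _ hL => ?_⟩
  obtain ⟨n₀, h⟩ := hJ.of_le hL
  refine eventually_atTop.2 ⟨n₀, fun n hn => ?_⟩
  rw [← h n hn, Ideal.span, hS]
  exact le_sup_left

/-- **Hilbert's theorem** for the graded module `⨁ Jₙ/Kₙ`, where `J` is a stable filtration. -/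
theorem exists_eventuallyEval_relativeLength [IsNoetherianRing A] [Module.Finite A N]
    {J K : I.Filtration N} (hJ : J.Stable) (hKJ : K ≤ J)
    (h : ∀ n, relativeLength (K.N n) (J.N n) ≠ ⊤) :
    ∃ P : ℚ[X], EventuallyEval P fun n => relativeLength (K.N n) (J.N n) := by
  obtain ⟨S, hS, hS'⟩ := exists_noetherianPair hJ
  exact (hS' K).exists_eventuallyEval S hS J K hKJ h

end HilbertFunction

/-! ### Colon submodules and Artin-Rees. -/

section SocleModulo

variable {A : Type*} [CommRing A] {N : Type*} [AddCommGroup N] [Module A N]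

/-- The submodule `K : 𝔪` of the elements that `𝔪` multiplies into `K`. -/
def socleModulo (m : Ideal A) (K : Submodule A N) : Submodule A N where
  carrier := {x | ∀ a ∈ m, a • x ∈ K}
  add_mem' hx hy a ha := by
    rw [smul_add]
    exact K.add_mem (hx a ha) (hy a ha)
  zero_mem' a _ := by simp
  smul_mem' r x hx a ha := by
    rw [smul_comm]
    exact K.smul_mem _ (hx a ha)

theorem le_socleModulo (m : Ideal A) (K : Submodule A N) : K ≤ socleModulo m K :=
  fun _ hx a _ => K.smul_mem a hx

theorem smul_socleModulo_le (m : Ideal A) (K : Submodule A N) : m • socleModulo m K ≤ K :=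
  Submodule.smul_le.2 fun a ha _ hx => hx a ha

theorem mem_socleModulo_span {s : Set A} {K : Submodule A N} {x : N} :
    x ∈ socleModulo (Ideal.span s) K ↔ ∀ a ∈ s, a • x ∈ K := by
  refine ⟨fun h a ha => h a (Ideal.subset_span ha), fun h a ha => ?_⟩
  have : Ideal.span s ≤ K.colon {x} := Ideal.span_le.2 fun a ha =>
    Submodule.mem_colon_singleton.2 (h a ha)
  exact Submodule.mem_colon_singleton.1 (this ha)

theorem mem_smul_top_pi {ι : Type*} [Finite ι] {I : Ideal A} {x : ι → N} :
    x ∈ I • (⊤ : Submodule A (ι → N)) ↔ ∀ i, x i ∈ I • (⊤ : Submodule A N) := by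
  classical
  have := Fintype.ofFinite ι
  constructor
  · intro h i
    have : I • (⊤ : Submodule A (ι → N)) ≤ (I • (⊤ : Submodule A N)).comap (LinearMap.proj i) :=
      Submodule.smul_le.2 fun a ha y _ => Submodule.smul_mem_smul ha trivial
    exact this h
  · intro h
    rw [← Finset.univ_sum_single x]
    refine Submodule.sum_mem _ fun i _ => ?_
    have : I • (⊤ : Submodule A N) ≤
        (I • (⊤ : Submodule A (ι → N))).comap (LinearMap.single A (fun _ => N) i) :=
      Submodule.smul_le.2 fun a ha y _ => by
        rw [Submodule.mem_comap, map_smul]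
        exact Submodule.smul_mem_smul ha trivial
    exact this (h i)

/-- The submodules `IⁿN : 𝔪` form, up to `0 : 𝔪`, a stable filtration. -/
theorem exists_socleModulo_pow_eq [IsNoetherianRing A] [Module.Finite A N] (m I : Ideal A) :
    ∃ c : ℕ, ∀ n, socleModulo m (I ^ (n + c) • ⊤ : Submodule A N) =
      I ^ n • socleModulo m (I ^ c • ⊤ : Submodule A N) ⊔ socleModulo m ⊥ := by
  obtain ⟨s, hs⟩ := IsNoetherian.noetherian m
  -- Multiplication by the generators of `𝔪`. The preimage of `Iⁿ(s → N)` is `IⁿN : 𝔪` and the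
  -- kernel is `0 : 𝔪`, so Artin-Rees for the range of `φ` pulls back to the claim.
  let φ : N →ₗ[A] (s → N) := LinearMap.pi fun a => LinearMap.lsmul A N a
  have hφ : ∀ n, (I ^ n • (⊤ : Submodule A (s → N))).comap φ =
      socleModulo m (I ^ n • ⊤ : Submodule A N) := by
    intro n
    ext x
    rw [← hs, Submodule.mem_comap, mem_smul_top_pi]
    refine Iff.trans ?_ mem_socleModulo_span.symm
    simp [φ]
  have hker : LinearMap.ker φ = socleModulo m ⊥ := by
    ext x
    rw [← hs]
    refine Iff.trans ?_ mem_socleModulo_span.symm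
    simp [φ, LinearMap.mem_ker, funext_iff]
  obtain ⟨c, hc⟩ := I.exists_pow_inf_eq_pow_smul (LinearMap.range φ)
  refine ⟨c, fun n => ?_⟩
  have h := hc (n + c) (by lia)
  rw [Nat.add_sub_cancel, ← Submodule.map_comap_eq_self (q := I ^ c • ⊤ ⊓ LinearMap.range φ)
    (f := φ) inf_le_right, ← Submodule.map_smul''] at h
  have h' := congrArg (Submodule.comap φ) h
  rw [Submodule.comap_map_eq, Submodule.comap_inf, Submodule.comap_inf, hφ, hφ, hker] at h'
  have hr : (LinearMap.range φ).comap φ = ⊤ := by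
    ext x
    simp
  rwa [hr, inf_top_eq, inf_top_eq] at h'

end SocleModulo

/-! ### Socle lengths over a local ring. -/

section LocalLength

open IsLocalRing

variable {A : Type*} [CommRing A] {N : Type*} [AddCommGroup N] [Module A N]

/-- The image of `J` in `N ⧸ K` lies in the span of the images of the `u i`, which is a quotient of
`ι → A ⧸ m`. -/
theorem relativeLength_le_card_mul {m : Ideal A} {K J : Submodule A N} {ι : Type*} [Fintype ι]
    (u : ι → N) (hu : J ≤ Submodule.span A (Set.range u) ⊔ K)
    (h : ∀ a ∈ m, ∀ i, a • u i ∈ K) :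
    relativeLength K J ≤ Fintype.card ι * Module.length A (A ⧸ m) := by
  classical
  let g : ∀ i, (A ⧸ m) →ₗ[A] N ⧸ K := fun i =>
    Submodule.liftQ m (LinearMap.toSpanSingleton A (N ⧸ K) (K.mkQ (u i))) fun a ha => by
      rw [LinearMap.mem_ker, LinearMap.toSpanSingleton_apply, ← map_smul, Submodule.mkQ_apply,
        Submodule.Quotient.mk_eq_zero]
      exact h a ha i
  have hg : ∀ i, g i (Submodule.Quotient.mk 1) = K.mkQ (u i) := fun i => by
    simp only [g]
    erw [Submodule.liftQ_apply]
    simp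
  let G : (ι → A ⧸ m) →ₗ[A] N ⧸ K := LinearMap.lsum A (fun _ => A ⧸ m) A g
  have hG : J.map K.mkQ ≤ LinearMap.range G := by
    refine (Submodule.map_mono hu).trans ?_
    rw [Submodule.map_sup, Submodule.map_span]
    refine sup_le (Submodule.span_le.2 ?_) ?_
    · rintro _ ⟨_, ⟨i, rfl⟩, rfl⟩
      refine ⟨Pi.single i (Submodule.Quotient.mk 1), ?_⟩
      rw [← hg]
      simp only [G, LinearMap.lsum_apply, LinearMap.sum_apply, LinearMap.comp_apply,
        LinearMap.proj_apply]
      rw [Finset.sum_eq_single i (fun j _ hj => by rw [Pi.single_eq_of_ne hj, map_zero])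
        (by simp), Pi.single_eq_same]
    · rw [Submodule.map_le_iff_le_comap]
      intro x hx
      rw [Submodule.mem_comap, Submodule.mkQ_apply, (Submodule.Quotient.mk_eq_zero K).2 hx]
      exact Submodule.zero_mem _
  rw [relativeLength_eq_length_map]
  calc _ ≤ Module.length A (LinearMap.range G) :=
        Module.length_le_of_injective (Submodule.inclusion hG) (Submodule.inclusion_injective _)
    _ ≤ Module.length A (ι → A ⧸ m) :=
        Module.length_le_of_surjective G.rangeRestrict G.surjective_rangeRestrict
    _ = _ := by
      rw [Module.length_pi_of_fintype]
      simp

variable [IsLocalRing A]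

theorem length_quotient_maximalIdeal : Module.length A (A ⧸ maximalIdeal A) = 1 := by
  rw [Module.length_eq_one_iff]
  exact isSimpleModule_iff_isCoatom.2 (Ideal.isMaximal_def.1 inferInstance)

theorem relativeLength_ne_top_of_smul_le [IsNoetherian A N] {K J : Submodule A N}
    (h : maximalIdeal A • J ≤ K) : relativeLength K J ≠ ⊤ := by
  obtain ⟨s, hs⟩ := IsNoetherian.noetherian J
  have h1 := relativeLength_le_card_mul (m := maximalIdeal A) (K := K) (J := J)
    (fun i : s => (i : N)) (by simp [hs]) fun a ha i => h (Submodule.smul_mem_smul ha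
      (hs ▸ Submodule.subset_span i.2))
  rw [length_quotient_maximalIdeal, mul_one] at h1
  exact ne_top_of_le_ne_top (ENat.natCast_ne_top _) h1

theorem relativeLength_ne_top_of_pow_smul_le [IsNoetherian A N] {K J : Submodule A N} (s : ℕ)
    (h : maximalIdeal A ^ s • J ≤ K) : relativeLength K J ≠ ⊤ := by
  induction s generalizing J with
  | zero =>
    rw [pow_zero, Ideal.one_eq_top, Submodule.top_smul] at h
    rw [relativeLength_eq_zero_iff.2 h]
    exact ENat.zero_ne_top
  | succ s ih =>
    rw [← relativeLength_sup, relativeLength_eq_add (L := maximalIdeal A • J ⊔ K) le_sup_right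
      (sup_le_sup_right Submodule.smul_le_right _), relativeLength_sup]
    refine WithTop.add_ne_top.2 ⟨ih ?_, relativeLength_ne_top_of_smul_le ?_⟩
    · rwa [← Submodule.mul_smul, ← pow_succ]
    · rw [Submodule.smul_sup]
      exact sup_le_sup_left Submodule.smul_le_right _

theorem relativeLength_socleModulo_ne_top [IsNoetherian A N] (K : Submodule A N) :
    relativeLength K (socleModulo (maximalIdeal A) K) ≠ ⊤ :=
  relativeLength_ne_top_of_smul_le (smul_socleModulo_le _ _)

variable [IsNoetherianRing A]

theorem length_quotient_pow_maximalIdeal_ne_top (s : ℕ) :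
    Module.length A (A ⧸ maximalIdeal A ^ s) ≠ ⊤ := by
  have h := relativeLength_ne_top_of_pow_smul_le (N := A) (K := maximalIdeal A ^ s) (J := ⊤) s
    (by rw [smul_eq_mul]; exact Ideal.mul_le_left)
  rw [relativeLength_eq_length_map, Submodule.map_top, Submodule.range_mkQ,
    Module.length_top] at h
  exact h

/-- The length of the socle of `N/IⁿN` is eventually a polynomial, and up to a constant it is the
Hilbert function of `⨁ IⁿD/Iⁿ⁺ᶜN` for some `D ≤ N`. -/
theorem exists_eventuallyEval_socle [Module.Finite A N] (I : Ideal A) :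
    (∃ P : ℚ[X], EventuallyEval P fun n =>
      relativeLength (I ^ n • ⊤) (socleModulo (maximalIdeal A) (I ^ n • ⊤ : Submodule A N))) ∧
    ∃ (c b : ℕ) (D : Submodule A N), (∀ n, maximalIdeal A • I ^ n • D ≤ I ^ (n + c) • ⊤) ∧ ∀ n,
      relativeLength (I ^ (n + c) • ⊤)
        (socleModulo (maximalIdeal A) (I ^ (n + c) • ⊤ : Submodule A N)) ≤
      relativeLength (I ^ (n + c) • ⊤) (I ^ n • D) + b := by
  obtain ⟨c, hc⟩ := exists_socleModulo_pow_eq (N := N) (maximalIdeal A) I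
  set D := socleModulo (maximalIdeal A) (I ^ c • ⊤ : Submodule A N) with hD
  set Z := socleModulo (maximalIdeal A) (⊥ : Submodule A N) with hZ
  have hle : ∀ n, (I ^ (n + c) • ⊤ : Submodule A N) ≤ I ^ n • D := fun n => by
    rw [pow_add, Submodule.mul_smul]
    exact smul_mono_right _ (le_socleModulo _ _)
  have hsum : ∀ n, relativeLength (I ^ (n + c) • ⊤)
      (socleModulo (maximalIdeal A) (I ^ (n + c) • ⊤ : Submodule A N)) =
      relativeLength (I ^ (n + c) • ⊤) (I ^ n • D) + relativeLength (I ^ n • D) Z := fun n => by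
    rw [hc, relativeLength_eq_add (hle n) le_sup_left, sup_comm, relativeLength_sup]
  have hZfin := relativeLength_socleModulo_ne_top (⊥ : Submodule A N)
  have hZle : ∀ K, relativeLength K Z ≤ relativeLength ⊥ Z := fun K =>
    relativeLength_anti bot_le
  have hm : ∀ n, maximalIdeal A • I ^ n • D ≤ I ^ (n + c) • ⊤ := fun n => by
    rw [← Submodule.mul_smul, mul_comm, Submodule.mul_smul, pow_add, Submodule.mul_smul]
    exact smul_mono_right _ (smul_socleModulo_le _ _)
  constructor
  · have hmono : Antitone fun n => I ^ n • D := fun k l hkl =>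
      Submodule.smul_mono_left (Ideal.pow_le_pow_right hkl)
    -- The contribution of `0 : 𝔪` increases with `n` and is bounded by its own finite length, hence
    -- is eventually constant.
    obtain ⟨k, hk⟩ := exists_eventuallyEval_of_monotone
      (f := fun n => relativeLength (I ^ n • D) Z)
      (fun k l hkl => relativeLength_anti (hmono hkl)) hZfin fun n => hZle _
    obtain ⟨P, hP⟩ := exists_eventuallyEval_relativeLength
      (K := shiftFiltration c (I.stableFiltration ⊤)) (I.stableFiltration_stable D)
      (fun n => hle n) fun n => relativeLength_ne_top_of_smul_le (hm n)
    exact ⟨_, EventuallyEval.shift c ((hP.add hk).congr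
      (Eventually.of_forall fun n => (hsum n).symm))⟩
  · refine ⟨c, (relativeLength ⊥ Z).toNat, D, hm, fun n => ?_⟩
    rw [hsum, ENat.natCast_toNat hZfin]
    gcongr
    exact hZle _

/-- A module killed by `𝔪ˢ` has length at most a constant times the length of its socle. -/
theorem exists_relativeLength_le_mul_socle [IsNoetherian A N] (s : ℕ) :
    ∃ C : ℕ, ∀ K J : Submodule A N, K ≤ J → maximalIdeal A ^ s • J ≤ K →
      relativeLength K J ≤ C * relativeLength K (socleModulo (maximalIdeal A) K) := by
  induction s with
  | zero =>
    refine ⟨0, fun K J _ h => ?_⟩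
    rw [pow_zero, Ideal.one_eq_top, Submodule.top_smul] at h
    simp [relativeLength_eq_zero_iff.2 h]
  | succ s ih =>
    obtain ⟨C, hC⟩ := ih
    obtain ⟨t, ht⟩ := IsNoetherian.noetherian (maximalIdeal A ^ s)
    refine ⟨C + t.card, fun K J hKJ h => ?_⟩
    -- Modulo `K`, `𝔪ˢ` kills `J'`, so induction applies to it. Multiplication by the generators `t`
    -- of `𝔪ˢ` embeds `J/J'` into `t.card` copies of the socle, because `𝔪 𝔪ˢ J ≤ K`. The constant
    -- is independent of `K` and `J`.
    set J' := J ⊓ socleModulo (maximalIdeal A ^ s) K with hJ'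
    have h1 : K ≤ J' := le_inf hKJ (le_socleModulo _ _)
    have h2 := hC K J' h1 ((smul_mono_right _ inf_le_right).trans (smul_socleModulo_le _ _))
    rw [relativeLength_eq_add h1 inf_le_left]
    push_cast
    rw [add_mul]
    refine add_le_add h2 ?_
    let φ : J →ₗ[A] (t → N ⧸ K) := LinearMap.pi fun a =>
      (K.mkQ ∘ₗ LinearMap.lsmul A N a) ∘ₗ J.subtype
    have hφ : LinearMap.ker φ = J'.submoduleOf J := by
      ext ⟨x, hx⟩
      have : x ∈ socleModulo (maximalIdeal A ^ s) K ↔ ∀ a ∈ (t : Set A), a • x ∈ K := by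
        rw [← ht]
        exact mem_socleModulo_span
      simp [Submodule.submoduleOf, hJ', this, φ, funext_iff, ← Submodule.Quotient.mk_smul,
        Submodule.Quotient.mk_eq_zero]
    rw [relativeLength_eq_length_range φ hφ, relativeLength_eq_length_map]
    set S := (socleModulo (maximalIdeal A) K).map K.mkQ with hS
    have hr : ∀ x ∈ LinearMap.range φ, ∀ a, x a ∈ S := by
      rintro _ ⟨⟨x, hx⟩, rfl⟩ a
      refine ⟨(a : A) • x, fun b hb => h ?_, rfl⟩
      rw [smul_smul, pow_succ']
      exact Submodule.smul_mem_smul (Ideal.mul_mem_mul hb (ht ▸ Submodule.subset_span a.2)) hx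
    let ψ : LinearMap.range φ →ₗ[A] (t → S) := LinearMap.pi fun a =>
      ((LinearMap.proj a).comp (LinearMap.range φ).subtype).codRestrict S fun x => hr _ x.2 a
    have hψ : Function.Injective ψ := by
      intro x y hxy
      ext a
      exact congrArg Subtype.val (congrFun hxy a)
    refine (Module.length_le_of_injective ψ hψ).trans ?_
    rw [Module.length_pi_of_fintype]
    simp

end LocalLength

/-! ### Artin-Rees over the Rees algebra. -/

section GradedArtinRees

variable {A : Type*} [CommRing A] {N : Type*} [AddCommGroup N] [Module A N]

/-- The Artin-Rees lemma for `H/K ⊆ E/K` when `𝔪` kills `H/K`. -/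
theorem exists_inf_pow_smul_sup_le {S P : Type*} [CommRing S] [IsNoetherianRing S]
    [AddCommGroup P] [Module S P] (m : Ideal S) {E H K : Submodule S P} (hE : E.FG) (hH : H ≤ E)
    (h : m • H ≤ K) : ∃ s, H ⊓ (m ^ s • E ⊔ K) ≤ K := by
  let E' := E.map K.mkQ
  have : Module.Finite S E' := Module.Finite.iff_fg.2 (hE.map _)
  let H' := (H.map K.mkQ).submoduleOf E'
  have hbot : m • H' = ⊥ := by
    rw [eq_bot_iff, Submodule.smul_le]
    rintro a ha ⟨_, _⟩ ⟨y, hy, rfl⟩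
    rw [Submodule.mem_bot]
    ext1
    change a • K.mkQ y = 0
    rw [← map_smul, Submodule.mkQ_apply, Submodule.Quotient.mk_eq_zero]
    exact h (Submodule.smul_mem_smul ha hy)
  obtain ⟨k, hk⟩ := m.exists_pow_inf_eq_pow_smul H'
  -- By Artin-Rees this is `m (mᵏE' ∩ H') ≤ m H' = 0`.
  have hk' : m ^ (k + 1) • ⊤ ⊓ H' = ⊥ := by
    rw [hk (k + 1) (by lia), Nat.add_sub_cancel_left, pow_one, eq_bot_iff, ← hbot]
    exact smul_mono_right _ inf_le_right
  refine ⟨k + 1, ?_⟩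
  rintro x ⟨hxH, hx⟩
  obtain ⟨y, hy, z, hz, rfl⟩ := Submodule.mem_sup.1 hx
  have hyz : K.mkQ (y + z) ∈ E' := Submodule.mem_map_of_mem (hH hxH)
  have h1 : K.mkQ (y + z) ∈ m ^ (k + 1) • E' := by
    have hz0 : K.mkQ z = 0 := by rwa [Submodule.mkQ_apply, Submodule.Quotient.mk_eq_zero]
    rw [map_add, hz0, add_zero, ← Submodule.map_smul'']
    exact Submodule.mem_map_of_mem hy
  have h2 : (⟨_, hyz⟩ : E') ∈ m ^ (k + 1) • (⊤ : Submodule S E') := by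
    have e : (m ^ (k + 1) • (⊤ : Submodule S E')).map E'.subtype = m ^ (k + 1) • E' := by
      rw [Submodule.map_smul'', Submodule.map_top, Submodule.range_subtype]
    rw [← e] at h1
    obtain ⟨w, hw, hw'⟩ := h1
    have : w = ⟨_, hyz⟩ := Subtype.ext hw'
    rwa [← this]
  have h3 : (⟨_, hyz⟩ : E') ∈ m ^ (k + 1) • ⊤ ⊓ H' := ⟨h2, Submodule.mem_map_of_mem hxH⟩
  rw [hk', Submodule.mem_bot] at h3
  have h4 : K.mkQ (y + z) = 0 := congrArg Subtype.val h3
  rwa [Submodule.mkQ_apply, Submodule.Quotient.mk_eq_zero] at h4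

theorem single_mem_filtration_submodule {I : Ideal A} {F : I.Filtration N} {n : ℕ} {x : N} :
    PolynomialModule.single A n x ∈ F.submodule ↔ x ∈ F.N n := by
  rw [Ideal.Filtration.mem_submodule]
  refine ⟨fun h => by simpa using h n, fun h i => ?_⟩
  rw [PolynomialModule.coeff_single, Finsupp.single_apply]
  split_ifs with hi
  · exact hi ▸ h
  · exact Submodule.zero_mem _

theorem map_smul_filtration_submodule_le {m I : Ideal A} {F G : I.Filtration N}
    (h : ∀ n, m • F.N n ≤ G.N n) :
    m.map (algebraMap A (reesAlgebra I)) • F.submodule ≤ G.submodule := by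
  have hle : m.map (algebraMap A (reesAlgebra I)) ≤
      Submodule.colon G.submodule (F.submodule : Set (PolynomialModule A N)) := by
    rw [Ideal.map_le_iff_le_comap]
    intro a ha
    rw [Ideal.mem_comap, Submodule.mem_colon]
    intro f hf i
    rw [algebraMap_smul]
    exact h i (Submodule.smul_mem_smul ha (hf i))
  rw [Submodule.smul_le]
  intro r hr f hf
  exact Submodule.mem_colon.1 (hle hr) f hf

theorem single_mem_map_smul {J I : Ideal A} {F : I.Filtration N} {n : ℕ} {x : N}
    (hx : x ∈ J • F.N n) :
    PolynomialModule.single A n x ∈ J.map (algebraMap A (reesAlgebra I)) • F.submodule := by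
  refine Submodule.smul_induction_on hx (fun a ha y hy => ?_) fun y z hy hz => ?_
  · have : PolynomialModule.single A n (a • y) =
        algebraMap A (reesAlgebra I) a • PolynomialModule.single A n y := by
      rw [algebraMap_smul]
      exact PolynomialModule.single_smul ..
    rw [this]
    exact Submodule.smul_mem_smul (Ideal.mem_map_of_mem _ ha)
      (single_mem_filtration_submodule.2 hy)
  · rw [PolynomialModule.single_add]
    exact Submodule.add_mem _ hy hz

variable [IsNoetherianRing A] [Module.Finite A N]

theorem stableFiltration_submodule_fg (I : Ideal A) (D : Submodule A N) :
    (I.stableFiltration D).submodule.FG :=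
  (Ideal.Filtration.submodule_fg_iff_stable _ fun _ => IsNoetherian.noetherian _).2
    (I.stableFiltration_stable D)

/-- Passing to the Rees modules, with `⨁ IⁿD` inside `⨁ IⁿN` modulo `⨁ Iⁿ⁺ᶜN`, makes a single
exponent `s` serve all degrees `n`. -/
theorem exists_inf_pow_smul_le (m I : Ideal A) (D : Submodule A N) (c : ℕ)
    (h : ∀ n, m • I ^ n • D ≤ I ^ (n + c) • ⊤) :
    ∃ s : ℕ, ∀ n, I ^ n • D ⊓ (m ^ s • I ^ n • ⊤ ⊔ I ^ (n + c) • ⊤) ≤ I ^ (n + c) • ⊤ := by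
  let E := I.stableFiltration (⊤ : Submodule A N)
  let K := shiftFiltration c (I.stableFiltration (⊤ : Submodule A N))
  let H := I.stableFiltration D
  obtain ⟨s, hs⟩ := exists_inf_pow_smul_sup_le (m.map (algebraMap A (reesAlgebra I)))
    (E := E.submodule) (H := H.submodule) (K := K.submodule) (stableFiltration_submodule_fg I _)
    (fun f hf i => (smul_mono_right _ le_top : I ^ i • D ≤ I ^ i • ⊤) (hf i)) (map_smul_filtration_submodule_le h)
  refine ⟨s, fun n x ⟨hxD, hx⟩ => ?_⟩
  obtain ⟨y, hy, z, hz, rfl⟩ := Submodule.mem_sup.1 hx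
  refine single_mem_filtration_submodule.1 (hs ⟨single_mem_filtration_submodule.2 hxD, ?_⟩)
  rw [PolynomialModule.single_add, ← Ideal.map_pow]
  exact Submodule.add_mem_sup (single_mem_map_smul hy) (single_mem_filtration_submodule.2 hz)

/-- Adding `𝔪ˢIⁿN` to `Iⁿ⁺ᶜN` does not change its intersection with `IⁿD`. The quotient therefore
sits inside a quotient of `IⁿN/𝔪ˢIⁿN`, whose length is at most the number of generators times that
of `A/𝔪ˢ`. -/
theorem exists_relativeLength_le_card_mul [IsLocalRing A] (I : Ideal A) (D : Submodule A N) (c : ℕ)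
    (h : ∀ n, IsLocalRing.maximalIdeal A • I ^ n • D ≤ I ^ (n + c) • ⊤) :
    ∃ C : ℕ, ∀ (n : ℕ) (U : Finset N), Submodule.span A (U : Set N) = I ^ n • ⊤ →
      relativeLength (I ^ (n + c) • ⊤) (I ^ n • D) ≤ U.card * C := by
  obtain ⟨s, hs⟩ := exists_inf_pow_smul_le _ I D c h
  refine ⟨(Module.length A (A ⧸ IsLocalRing.maximalIdeal A ^ s)).toNat, fun n U hU => ?_⟩
  rw [ENat.natCast_toNat (length_quotient_pow_maximalIdeal_ne_top s)]
  set Q := IsLocalRing.maximalIdeal A ^ s • I ^ n • ⊤ ⊔ I ^ (n + c) • (⊤ : Submodule A N)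
  have h1 : relativeLength (I ^ (n + c) • ⊤) (I ^ n • D) = relativeLength Q (I ^ n • D) := by
    have e : (I ^ (n + c) • ⊤ : Submodule A N).submoduleOf (I ^ n • D) =
        Q.submoduleOf (I ^ n • D) := by
      ext ⟨x, hx⟩
      exact ⟨fun h => Submodule.mem_sup_right h, fun h => hs n ⟨hx, h⟩⟩
    rw [relativeLength, e, relativeLength]
  calc _ = relativeLength Q (I ^ n • D) := h1
    _ ≤ relativeLength Q (I ^ n • ⊤) := relativeLength_mono (smul_mono_right _ le_top)
    _ ≤ Fintype.card U * _ := relativeLength_le_card_mul (fun u : U => (u : N)) (by simp [hU])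
        fun a ha u => Submodule.mem_sup_left
          (Submodule.smul_mem_smul ha (hU ▸ Submodule.subset_span u.2))
    _ = _ := by rw [Fintype.card_coe]

end GradedArtinRees

/-! ### Growth of finitely generated algebras over a field. -/

section GelfandKirillov

open Module

/-- Lying over lifts the smallest prime of a chain, and going up lifts the rest. -/
theorem ringKrullDim_le_of_isIntegral_of_injective {R S : Type*} [CommRing R] [CommRing S]
    (f : R →+* S) (hf : f.IsIntegral) (hf' : Function.Injective f) :
    ringKrullDim R ≤ ringKrullDim S := by
  algebraize [f]
  refine iSup_le fun l => ?_
  obtain ⟨P, -, hP, hP'⟩ := Ideal.exists_ideal_over_prime_of_isIntegral (S := S)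
    l.head.asIdeal ⊥ (by
      change RingHom.ker f ≤ _
      rw [(RingHom.injective_iff_ker_eq_bot f).1 hf']
      exact bot_le)
  have : P.LiesOver l.head.asIdeal := ⟨hP'.symm⟩
  obtain ⟨L, hL, -⟩ := Ideal.exists_ltSeries_of_hasGoingUp l P
  rw [← hL]
  exact Order.LTSeries.length_le_krullDim L

variable {k B : Type*} [Field k] [CommRing B] [Algebra k B]

/-- The span of the monomials in `z` all of whose exponents are at most `D`. -/
def boundedMonomials (k : Type*) [Field k] [Algebra k B] {s : ℕ} (z : Fin s → B) (D : ℕ) :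
    Submodule k B :=
  Submodule.span k (Set.range fun e : Fin s → Fin (D + 1) => ∏ i, z i ^ (e i : ℕ))

variable {s : ℕ} (z : Fin s → B)

theorem prod_mem_boundedMonomials {D : ℕ} (e : Fin s → ℕ) (h : ∀ i, e i ≤ D) :
    ∏ i, z i ^ e i ∈ boundedMonomials k z D :=
  Submodule.subset_span ⟨fun i => ⟨e i, Nat.lt_succ_of_le (h i)⟩, rfl⟩

theorem boundedMonomials_mono : Monotone (boundedMonomials k z) := by
  intro D E h
  rw [boundedMonomials, Submodule.span_le]
  rintro _ ⟨e, rfl⟩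
  exact prod_mem_boundedMonomials z _ fun i => by lia

theorem boundedMonomials_mul_le (D E : ℕ) :
    boundedMonomials k z D * boundedMonomials k z E ≤ boundedMonomials k z (D + E) := by
  rw [boundedMonomials, boundedMonomials, Submodule.span_mul_span, Submodule.span_le]
  rintro _ ⟨_, ⟨e, rfl⟩, _, ⟨f, rfl⟩, rfl⟩
  dsimp only
  rw [← Finset.prod_mul_distrib]
  simp_rw [← pow_add]
  exact prod_mem_boundedMonomials z _ fun i => by lia

theorem finrank_boundedMonomials_le (D : ℕ) :
    finrank k (boundedMonomials k z D) ≤ (D + 1) ^ s := by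
  refine (finrank_range_le_card _).trans ?_
  simp

instance (D : ℕ) : Module.Finite k (boundedMonomials k z D) :=
  Module.Finite.span_of_finite k (Set.finite_range _)

theorem exists_aeval_mem_boundedMonomials (p : MvPolynomial (Fin s) k) :
    ∃ D, MvPolynomial.aeval z p ∈ boundedMonomials k z D := by
  have h1 : (1 : B) ∈ boundedMonomials k z 0 := by
    simpa using prod_mem_boundedMonomials (k := k) z (D := 0) (fun _ => 0) (by simp)
  induction p using MvPolynomial.induction_on with
  | C a =>
    refine ⟨0, ?_⟩
    rw [MvPolynomial.aeval_C, Algebra.algebraMap_eq_smul_one]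
    exact Submodule.smul_mem _ _ h1
  | add p q hp hq =>
    obtain ⟨D, hD⟩ := hp
    obtain ⟨E, hE⟩ := hq
    refine ⟨max D E, ?_⟩
    rw [map_add]
    exact Submodule.add_mem _ (boundedMonomials_mono z (le_max_left _ _) hD)
      (boundedMonomials_mono z (le_max_right _ _) hE)
  | mul_X p i hp =>
    obtain ⟨D, hD⟩ := hp
    refine ⟨D + 1, ?_⟩
    rw [map_mul, MvPolynomial.aeval_X]
    refine boundedMonomials_mul_le z D 1 (Submodule.mul_mem_mul hD ?_)
    classical
    have := prod_mem_boundedMonomials (k := k) z (D := 1) (fun j => if j = i then 1 else 0)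
      (fun j => by split_ifs <;> simp)
    simpa [Finset.prod_ite_eq', pow_ite] using this

theorem finrank_mul_le (P Q : Submodule k B) [Module.Finite k P] [Module.Finite k Q] :
    finrank k (P * Q : Submodule k B) ≤ finrank k P * finrank k Q := by
  rw [← Submodule.mulMap_range, ← Module.finrank_tensorProduct]
  exact LinearMap.finrank_range_le _

variable (k B) in
/-- The dimensions of the powers of a finite-dimensional subspace `V` of a finitely generated
algebra `B` grow with degree at most `dim B`. -/
theorem exists_finrank_pow_le [Nontrivial B] [Algebra.FiniteType k B] :
    ∃ s : ℕ, (s : WithBot ℕ∞) ≤ ringKrullDim B ∧ ∀ V : Submodule k B, V.FG →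
      ∃ C : ℕ, ∀ n, finrank k (V ^ n : Submodule k B) ≤ C * (n + 1) ^ s := by
  obtain ⟨s, g, hg, hfin⟩ := exists_finite_inj_algHom_of_fg k B
  refine ⟨s, ?_, fun V hV => ?_⟩
  · have := ringKrullDim_le_of_isIntegral_of_injective g.toRingHom hfin.to_isIntegral hg
    rw [MvPolynomial.ringKrullDim_of_isNoetherianRing, ringKrullDim_eq_zero_of_field] at this
    simpa using this
  let z : Fin s → B := fun i => g (MvPolynomial.X i)
  have hz : ∀ p, g p = MvPolynomial.aeval z p := fun p =>
    congrArg (fun f => f p) (MvPolynomial.aeval_unique g)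
  obtain ⟨b, hb⟩ : ∃ b : Finset B, ∀ v, ∃ c : B → MvPolynomial (Fin s) k,
      v = ∑ x ∈ b, g (c x) * x := by
    let _ := g.toRingHom.toAlgebra
    have : Module.Finite (MvPolynomial (Fin s) k) B := hfin
    obtain ⟨b, hb⟩ := this.fg_top
    refine ⟨b, fun v => ?_⟩
    obtain ⟨c, -, hc⟩ := Submodule.mem_span_finset.1
      (hb ▸ Submodule.mem_top : v ∈ Submodule.span (MvPolynomial (Fin s) k) (b : Set B))
    exact ⟨c, hc.symm⟩
  -- `T` contains generators of `B` over the polynomial ring of the Noether normalization, and also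
  -- 1, so that `V ^ n ≤ V ^ n * T`.
  let T : Submodule k B := Submodule.span k (insert 1 (b : Set B))
  have hT : T.FG := Submodule.fg_span (by simp)
  have : Module.Finite k T := Module.Finite.iff_fg.2 hT
  have h1 : ∀ v, ∃ D, v ∈ boundedMonomials k z D * T := by
    intro v
    obtain ⟨c, rfl⟩ := hb v
    choose D hD using fun x => exists_aeval_mem_boundedMonomials z (c x)
    refine ⟨b.sup D, Submodule.sum_mem _ fun x hx => Submodule.mul_mem_mul ?_ ?_⟩
    · rw [hz]
      exact boundedMonomials_mono z (Finset.le_sup hx) (hD x)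
    · exact Submodule.subset_span (Set.mem_insert_of_mem _ hx)
  obtain ⟨D, hD⟩ : ∃ D, V * T ≤ boundedMonomials k z D * T := by
    obtain ⟨t, ht⟩ := hV.mul hT
    choose D hD using h1
    refine ⟨t.sup D, ?_⟩
    rw [← ht, Submodule.span_le]
    intro x hx
    exact mul_le_mul_left (boundedMonomials_mono z (Finset.le_sup hx)) T (hD x)
  -- Each factor from `V` raises the exponents by at most `D`, so `V ^ n` has dimension at most `(nD
  -- + 1) ^ s` times that of `T`.
  have key : ∀ n, V ^ n * T ≤ boundedMonomials k z (n * D) * T := by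
    intro n
    induction n with
    | zero =>
      rw [pow_zero]
      refine mul_le_mul_left ?_ T
      rw [Submodule.one_le]
      simpa using prod_mem_boundedMonomials (k := k) z (D := 0 * D) (fun _ => 0) (by simp)
    | succ n ih =>
      calc V ^ (n + 1) * T = V ^ n * (V * T) := by rw [pow_succ, mul_assoc]
        _ ≤ V ^ n * (boundedMonomials k z D * T) := mul_le_mul_right hD _
        _ = boundedMonomials k z D * (V ^ n * T) := mul_left_comm _ _ _
        _ ≤ boundedMonomials k z D * (boundedMonomials k z (n * D) * T) :=
          mul_le_mul_right ih _
        _ = (boundedMonomials k z D * boundedMonomials k z (n * D)) * T := (mul_assoc _ _ _).symm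
        _ ≤ boundedMonomials k z (D + n * D) * T :=
          mul_le_mul_left (boundedMonomials_mul_le z _ _) T
        _ = _ := by congr 2; ring
  refine ⟨(D + 1) ^ s * finrank k T, fun n => ?_⟩
  have hVT : V ^ n ≤ V ^ n * T := by
    intro x hx
    simpa using Submodule.mul_mem_mul hx (Submodule.subset_span (Set.mem_insert 1 _) : (1 : B) ∈ T)
  have hfg : (boundedMonomials k z (n * D) * T).FG :=
    (Module.Finite.iff_fg.1 inferInstance).mul hT
  have : Module.Finite k (boundedMonomials k z (n * D) * T : Submodule k B) :=
    Module.Finite.iff_fg.2 hfg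
  calc finrank k (V ^ n : Submodule k B)
      ≤ finrank k (boundedMonomials k z (n * D) * T : Submodule k B) :=
        Submodule.finrank_mono (hVT.trans (key n))
    _ ≤ finrank k (boundedMonomials k z (n * D)) * finrank k T := finrank_mul_le _ _
    _ ≤ (n * D + 1) ^ s * finrank k T := by
        gcongr
        exact finrank_boundedMonomials_le z _
    _ ≤ ((D + 1) * (n + 1)) ^ s * finrank k T := by
        gcongr
        nlinarith
    _ = _ := by rw [mul_pow]; ring

end GelfandKirillov

/-! ### Numbers of generators and the fibre cone. -/

section FiberCone

open IsLocalRing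

theorem length_map_le_of_ker_le {A X Y Z : Type*} [CommRing A] [AddCommGroup X] [Module A X]
    [AddCommGroup Y] [Module A Y] [AddCommGroup Z] [Module A Z] (q : X →ₗ[A] Y) (c : X →ₗ[A] Z)
    (h : LinearMap.ker q ≤ LinearMap.ker c) :
    Module.length A (LinearMap.range c) ≤ Module.length A (LinearMap.range q) := by
  rw [← q.quotKerEquivRange.length_eq, ← c.quotKerEquivRange.length_eq]
  exact Module.length_le_of_surjective (Submodule.factor h) (Submodule.factor_surjective h)

variable {A : Type*} [CommRing A] {N : Type*} [AddCommGroup N] [Module A N]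

theorem spanFinrank_le_relativeLength [IsLocalRing A] {J : Submodule A N} (hJ : J.FG) :
    (J.spanFinrank : ℕ∞) ≤ relativeLength (maximalIdeal A • J) J := by
  have e : (maximalIdeal A • J).submoduleOf J = maximalIdeal A • (⊤ : Submodule A J) := by
    apply Submodule.map_injective_of_injective J.subtype_injective
    rw [Submodule.map_smul'', Submodule.map_top, Submodule.range_subtype, Submodule.submoduleOf,
      Submodule.map_comap_subtype, inf_eq_right]
    exact Submodule.smul_le_right
  let _ : Field (A ⧸ maximalIdeal A) := Ideal.Quotient.field _
  have : Module.Finite A J := Module.Finite.iff_fg.2 hJ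
  have : Module.Finite (A ⧸ maximalIdeal A) (J ⧸ maximalIdeal A • (⊤ : Submodule A J)) :=
    Module.Finite.of_restrictScalars_finite A _ _
  rw [relativeLength, e, IsLocalRing.spanFinrank_eq_finrank_quotient J hJ,
    Module.length_eq_of_surjective (R := A ⧸ maximalIdeal A) Ideal.Quotient.mk_surjective,
    Module.length_eq_finrank]

/-- The element `a t` of the Rees algebra. -/
noncomputable def reesMonomial (I : Ideal A) (i : ℕ) : ↥(I ^ i) →ₗ[A] reesAlgebra I where
  toFun a := ⟨monomial i (a : A), reesAlgebra.monomial_mem.2 a.2⟩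
  map_add' a b := by
    ext1
    simp
  map_smul' r a := by
    ext1
    simp [smul_monomial]

noncomputable def reesSingle (I : Ideal A) (N : Type*) [AddCommGroup N] [Module A N] (i : ℕ) :
    (I ^ i • ⊤ : Submodule A N) →ₗ[A] (I.stableFiltration (⊤ : Submodule A N)).submodule where
  toFun x := ⟨PolynomialModule.single A i (x : N), single_mem_filtration_submodule.2 x.2⟩
  map_add' a b := by
    ext1
    exact PolynomialModule.single_add ..
  map_smul' r a := by
    ext1
    exact PolynomialModule.single_smul ..

variable {I : Ideal A} {B : Type*} [CommRing B] [Algebra A B]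
  (π : reesAlgebra I →ₐ[A] B)

/-- The Rees algebra is generated over `A` in degree 1: elements of `Iⁱ` are sums of `i`-fold
products from `I`. -/
theorem map_reesMonomial_mem_pow {V : Submodule A B} (hV : ∀ a, π (reesMonomial I 1 a) ∈ V)
    (i : ℕ) (a : ↥(I ^ i)) : π (reesMonomial I i a) ∈ V ^ i := by
  induction i with
  | zero =>
    rw [pow_zero, Submodule.mem_one]
    refine ⟨a, ?_⟩
    rw [← π.commutes]
    rfl
  | succ i ih =>
    obtain ⟨a, ha⟩ := a
    have hle : I ^ (i + 1) ≤ I ^ (i + 1) := le_rfl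
    suffices h : ∀ a ∈ I ^ i * I, ∃ ha : a ∈ I ^ (i + 1),
        π (reesMonomial I (i + 1) ⟨a, ha⟩) ∈ V ^ (i + 1) by
      obtain ⟨_, h⟩ := h a (by rwa [← pow_succ])
      exact h
    intro a ha
    refine Submodule.mul_induction_on ha (fun x hx y hy => ?_) fun x y hx hy => ?_
    · have hxy : x * y ∈ I ^ (i + 1) := by
        rw [pow_succ]
        exact Ideal.mul_mem_mul hx hy
      refine ⟨hxy, ?_⟩
      have hy' : y ∈ I ^ 1 := by rwa [pow_one]
      have e : reesMonomial I (i + 1) ⟨x * y, hxy⟩ =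
          reesMonomial I i ⟨x, hx⟩ * reesMonomial I 1 ⟨y, hy'⟩ := by
        ext1
        exact (monomial_mul_monomial ..).symm
      rw [e, map_mul, pow_succ]
      exact Submodule.mul_mem_mul (ih _) (hV _)
    · obtain ⟨hx, hx'⟩ := hx
      obtain ⟨hy, hy'⟩ := hy
      refine ⟨Ideal.add_mem _ hx hy, ?_⟩
      have e : reesMonomial I (i + 1) ⟨x + y, Ideal.add_mem _ hx hy⟩ =
          reesMonomial I (i + 1) ⟨x, hx⟩ + reesMonomial I (i + 1) ⟨y, hy⟩ :=
        (reesMonomial I (i + 1)).map_add ⟨x, hx⟩ ⟨y, hy⟩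
      rw [e, map_add]
      exact Submodule.add_mem _ hx' hy'

variable {F : Type*} [AddCommGroup F] [Module B F]

/-- Compare the image under `q` of the part of degree below `n` with two modules. By `hker` it is at
least as long as the sum of the `IⁱN/𝔪IⁱN`, which count generators by Nakayama. As `⨁ IⁱN` is
generated in degree 0, it lies in `V ^ n` times the image of `N`, a quotient of as many copies of `V
^ n` as `N` has generators. -/
theorem sum_spanFinrank_le [IsLocalRing A] [IsNoetherianRing A] [Module.Finite A N]
    (q : (I.stableFiltration (⊤ : Submodule A N)).submodule →+ F)
    (hq : ∀ s e, q (s • e) = π s • q e)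
    (hker : ∀ e, q e = 0 → ∀ i, (e : PolynomialModule A N).coeff i ∈
      maximalIdeal A • I ^ i • (⊤ : Submodule A N))
    {V : Submodule A B} (h1 : 1 ∈ V) (hV : ∀ a, π (reesMonomial I 1 a) ∈ V) (n : ℕ) :
    ∑ i ∈ Finset.range n, ((I ^ i • ⊤ : Submodule A N).spanFinrank : ℕ∞) ≤
      (⊤ : Submodule A N).spanFinrank * Module.length A ↥(V ^ n) := by
  classical
  let _ : Module A F := Module.compHom F (algebraMap A B)
  have : IsScalarTower A B F := ⟨fun a b x => by
    rw [Algebra.smul_def, mul_smul]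
    rfl⟩
  let E := (I.stableFiltration (⊤ : Submodule A N)).submodule
  let q' : E →ₗ[A] F :=
    { q with
      map_smul' := fun a e => by
        change q (a • e) = algebraMap A B a • q e
        rw [← algebraMap_smul (reesAlgebra I) a e, hq, π.commutes] }
  let X := ∀ i : Fin n, (I ^ (i : ℕ) • ⊤ : Submodule A N)
  let Φ : X →ₗ[A] E := LinearMap.lsum A (fun i : Fin n => (I ^ (i : ℕ) • ⊤ : Submodule A N)) A
    fun i => reesSingle I N i
  have hΦ : ∀ x : X, Φ x = ∑ i : Fin n, reesSingle I N (i : ℕ) (x i) := fun x => by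
    simp [Φ, LinearMap.lsum_apply]
    rfl
  have hcoeff : ∀ (x : X) (i : Fin n), (Φ x : PolynomialModule A N).coeff i = x i := by
    intro x i
    rw [hΦ, Submodule.coe_sum, PolynomialModule.coeff_sum, Finset.sum_apply']
    rw [Finset.sum_eq_single i]
    · simp [reesSingle]
    · intro j _ hj
      simp [reesSingle, Fin.val_inj, hj]
    · simp
  let c : ∀ i : Fin n, (I ^ (i : ℕ) • ⊤ : Submodule A N) →ₗ[A]
      N ⧸ maximalIdeal A • I ^ (i : ℕ) • (⊤ : Submodule A N) := fun i =>
    (Submodule.mkQ _) ∘ₗ (Submodule.subtype _)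
  let c' : X →ₗ[A] ∀ i : Fin n, N ⧸ maximalIdeal A • I ^ (i : ℕ) • (⊤ : Submodule A N) :=
    LinearMap.pi fun i => c i ∘ₗ LinearMap.proj i
  let ψ : (∀ i : Fin n, LinearMap.range (c i)) →ₗ[A] LinearMap.range c' :=
    LinearMap.codRestrict (LinearMap.range c')
      (LinearMap.pi fun i => (Submodule.subtype _) ∘ₗ LinearMap.proj i) fun y => by
        choose x hx using fun i => (y i).2
        refine ⟨x, ?_⟩
        ext i
        exact hx i
  have hψ : Function.Injective ψ := by
    intro x y hxy
    ext i
    exact congrFun (congrArg Subtype.val hxy) i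
  have hker' : LinearMap.ker (q' ∘ₗ Φ) ≤ LinearMap.ker c' := by
    intro x hx
    rw [LinearMap.mem_ker]
    ext i
    change Submodule.Quotient.mk (x i : N) = 0
    rw [Submodule.Quotient.mk_eq_zero, ← hcoeff]
    exact hker _ hx _
  obtain ⟨U, hUcard, hU⟩ :=
    (IsNoetherian.noetherian (⊤ : Submodule A N)).exists_span_finset_card_eq_spanFinrank
  let e₀ : N →ₗ[A] E := reesSingle I N 0 ∘ₗ LinearMap.codRestrict _ LinearMap.id (fun y => by simp)
  let Ψ : (U → ↥(V ^ n)) →ₗ[A] F := LinearMap.lsum A (fun _ : U => ↥(V ^ n)) A fun u =>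
    (LinearMap.toSpanSingleton B F (q' (e₀ u))).restrictScalars A ∘ₗ (V ^ n).subtype
  have hΨ : ∀ y : N, ∀ b ∈ V ^ n, b • q' (e₀ y) ∈ LinearMap.range Ψ := by
    intro y b hb
    have hy : y ∈ Submodule.span A (U : Set N) := hU ▸ Submodule.mem_top
    induction hy using Submodule.span_induction with
    | mem y hy =>
      refine ⟨Pi.single ⟨y, hy⟩ ⟨b, hb⟩, ?_⟩
      simp only [Ψ, LinearMap.lsum_apply, LinearMap.sum_apply, LinearMap.comp_apply,
        LinearMap.proj_apply]
      rw [Finset.sum_eq_single ⟨y, hy⟩ (fun j _ hj => by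
        rw [Pi.single_eq_of_ne hj, map_zero, map_zero]) (by simp), Pi.single_eq_same]
      rfl
    | zero => simp
    | add y z _ _ hy hz =>
      rw [map_add, map_add, smul_add]
      exact Submodule.add_mem _ hy hz
    | smul r y _ hy =>
      rw [map_smul, map_smul, smul_comm]
      exact Submodule.smul_mem _ _ hy
  -- Since `1 ∈ V`, the powers of `V` increase, and one power takes care of all degrees.
  have hVn : ∀ i ≤ n, V ^ i ≤ V ^ n := fun i hi =>
    pow_le_pow_right₀ (Submodule.one_le.2 h1) hi
  have hrange : ∀ i ≤ n, ∀ x : (I ^ i • ⊤ : Submodule A N),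
      q' (reesSingle I N i x) ∈ LinearMap.range Ψ := by
    rintro i hi ⟨x, hx⟩
    suffices h : ∃ hx : x ∈ (I ^ i • ⊤ : Submodule A N),
        q' (reesSingle I N i ⟨x, hx⟩) ∈ LinearMap.range Ψ from h.2
    refine Submodule.smul_induction_on hx (fun a ha y _ => ?_) fun x y hx hy => ?_
    · have hay : a • y ∈ (I ^ i • ⊤ : Submodule A N) := Submodule.smul_mem_smul ha trivial
      refine ⟨hay, ?_⟩
      have e : reesSingle I N i ⟨a • y, hay⟩ = reesMonomial I i ⟨a, ha⟩ • e₀ y := by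
        ext1
        refine Eq.trans ?_ (PolynomialModule.monomial_smul_single i a 0 y).symm
        rw [add_zero]
        rfl
      rw [e]
      change q _ ∈ _
      rw [hq]
      exact hΨ _ _ (hVn i hi (map_reesMonomial_mem_pow π hV i _))
    · obtain ⟨hx, hx'⟩ := hx
      obtain ⟨hy, hy'⟩ := hy
      refine ⟨Submodule.add_mem _ hx hy, ?_⟩
      have e : reesSingle I N i ⟨x + y, Submodule.add_mem _ hx hy⟩ =
          reesSingle I N i ⟨x, hx⟩ + reesSingle I N i ⟨y, hy⟩ :=
        (reesSingle I N i).map_add ⟨x, hx⟩ ⟨y, hy⟩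
      rw [e, map_add]
      exact Submodule.add_mem _ hx' hy'
  have hle : LinearMap.range (q' ∘ₗ Φ) ≤ LinearMap.range Ψ := by
    rintro _ ⟨x, rfl⟩
    rw [LinearMap.comp_apply, hΦ, map_sum]
    exact Submodule.sum_mem _ fun i _ => hrange i i.2.le _
  calc ∑ i ∈ Finset.range n, ((I ^ i • ⊤ : Submodule A N).spanFinrank : ℕ∞)
      = ∑ i : Fin n, ((I ^ (i : ℕ) • ⊤ : Submodule A N).spanFinrank : ℕ∞) :=
        (Fin.sum_univ_eq_sum_range
          (fun i => ((I ^ i • ⊤ : Submodule A N).spanFinrank : ℕ∞)) n).symm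
    _ ≤ ∑ i : Fin n, Module.length A (LinearMap.range (c i)) := by
        refine Finset.sum_le_sum fun i _ => ?_
        rw [← relativeLength_eq_length_range (K := maximalIdeal A • I ^ (i : ℕ) • ⊤)
          (J := I ^ (i : ℕ) • ⊤) (c i)]
        · exact spanFinrank_le_relativeLength (IsNoetherian.noetherian _)
        · rw [LinearMap.ker_comp, Submodule.ker_mkQ]
          rfl
    _ = Module.length A (∀ i : Fin n, LinearMap.range (c i)) :=
        (Module.length_pi_of_fintype A _).symm
    _ ≤ Module.length A (LinearMap.range c') := Module.length_le_of_injective ψ hψ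
    _ ≤ Module.length A (LinearMap.range (q' ∘ₗ Φ)) := length_map_le_of_ker_le _ _ hker'
    _ ≤ Module.length A (LinearMap.range Ψ) :=
        Module.length_le_of_injective (Submodule.inclusion hle) (Submodule.inclusion_injective _)
    _ ≤ Module.length A (U → ↥(V ^ n)) :=
        Module.length_le_of_surjective Ψ.rangeRestrict Ψ.surjective_rangeRestrict
    _ = _ := by
        rw [Module.length_pi_of_fintype, ← hUcard]
        simp

end FiberCone

/-! ### The analytic spread bounds the growth of the numbers of generators. -/

section AnalyticSpreadGrowth

open IsLocalRing

variable {A : Type*} [CommRing A] [IsLocalRing A]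

/-- Growth of the powers of a finitely generated submodule of an algebra killed by `𝔪`. -/
theorem exists_length_pow_le (B : Type*) [CommRing B] [Nontrivial B] [Algebra A B]
    [Algebra.FiniteType A B] (h : ∀ a ∈ maximalIdeal A, algebraMap A B a = 0) :
    ∃ s : ℕ, (s : WithBot ℕ∞) ≤ ringKrullDim B ∧ ∀ V : Submodule A B, V.FG →
      ∃ C : ℕ, ∀ n : ℕ, Module.length A ↥(V ^ n) ≤ C * (n + 1) ^ s := by
  let _ : Field (A ⧸ maximalIdeal A) := Ideal.Quotient.field _
  let _ : Algebra (A ⧸ maximalIdeal A) B := (Ideal.Quotient.lift _ (algebraMap A B) h).toAlgebra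
  have : IsScalarTower A (A ⧸ maximalIdeal A) B := IsScalarTower.of_algebraMap_eq fun a => rfl
  have : Algebra.FiniteType (A ⧸ maximalIdeal A) B :=
    Algebra.FiniteType.of_restrictScalars_finiteType A _ B
  obtain ⟨s, hs, hV⟩ := exists_finrank_pow_le (A ⧸ maximalIdeal A) B
  refine ⟨s, hs, fun V hVfg => ?_⟩
  obtain ⟨t, rfl⟩ := hVfg
  obtain ⟨C, hC⟩ := hV (Submodule.span _ (t : Set B)) ⟨t, rfl⟩
  refine ⟨C, fun n => ?_⟩
  set W := Submodule.span (A ⧸ maximalIdeal A) (t : Set B)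
  have hfin : Module.Finite (A ⧸ maximalIdeal A) ↥(W ^ n) :=
    Module.Finite.iff_fg.2 (Submodule.FG.pow ⟨t, rfl⟩ n)
  have hle : ∀ (n : ℕ) (x : B), x ∈ Submodule.span A (t : Set B) ^ n → x ∈ W ^ n := by
    intro n
    induction n with
    | zero =>
      intro x hx
      rw [pow_zero] at hx ⊢
      obtain ⟨a, rfl⟩ := Submodule.mem_one.1 hx
      exact Submodule.mem_one.2 ⟨algebraMap A _ a, rfl⟩
    | succ n ih =>
      intro x hx
      rw [pow_succ] at hx ⊢
      refine Submodule.mul_induction_on hx (fun x hx y hy => ?_) fun x y hx hy => add_mem hx hy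
      have hy' : y ∈ W := Submodule.span_le_restrictScalars A (A ⧸ maximalIdeal A) (t : Set B) hy
      exact Submodule.mul_mem_mul (ih x hx) hy'
  let j : ↥(Submodule.span A (t : Set B) ^ n) →ₗ[A] ↥(W ^ n) :=
    { toFun := fun x => ⟨x, hle n x x.2⟩
      map_add' := fun _ _ => rfl
      map_smul' := fun _ _ => rfl }
  have hj : Function.Injective j := fun x y hxy => Subtype.ext (congrArg (fun z : ↥(W ^ n) => (z : B)) hxy)
  calc Module.length A ↥(Submodule.span A (t : Set B) ^ n)
      ≤ Module.length A ↥(W ^ n) := Module.length_le_of_injective j hj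
    _ = Module.length (A ⧸ maximalIdeal A) ↥(W ^ n) :=
        Module.length_eq_of_surjective (M := ↥(W ^ n)) Ideal.Quotient.mk_surjective
    _ = Module.finrank (A ⧸ maximalIdeal A) ↥(W ^ n) := Module.length_eq_finrank _ _
    _ ≤ _ := by exact_mod_cast hC n

variable [IsNoetherianRing A] {N : Type*} [AddCommGroup N] [Module A N] [Module.Finite A N]

/-- The support of `F` has the dimension of `G/Ann F`, a finitely generated algebra killed by `𝔪`.
Its growth is measured on the submodule `V` generated by 1 and the image of degree 1. -/
theorem exists_sum_spanFinrank_le_supportDim {I : Ideal A} {G : Type*} [CommRing G] [Algebra A G]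
    {F : Type*} [AddCommGroup F] [Module G F] [Module.Finite G F] [Nontrivial F]
    (hm : ∀ a ∈ maximalIdeal A, algebraMap A G a ∈ Module.annihilator G F)
    (π : reesAlgebra I →ₐ[A] G) (hπ : Function.Surjective π)
    (q : (I.stableFiltration (⊤ : Submodule A N)).submodule →+ F)
    (hq : ∀ s e, q (s • e) = π s • q e)
    (hker : ∀ e, q e = 0 → ∀ i, (e : PolynomialModule A N).coeff i ∈
      maximalIdeal A • I ^ i • (⊤ : Submodule A N)) :
    ∃ s C : ℕ, (s : WithBot ℕ∞) ≤ Module.supportDim G F ∧ ∀ n : ℕ,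
      ∑ i ∈ Finset.range n, ((I ^ i • ⊤ : Submodule A N).spanFinrank : ℕ∞) ≤ C * (n + 1) ^ s := by
  let B := G ⧸ Module.annihilator G F
  let _ : Module B F := Module.quotientAnnihilator
  let φ : G →ₐ[A] B := Ideal.Quotient.mkₐ A (Module.annihilator G F)
  have hφ : Function.Surjective φ := Ideal.Quotient.mk_surjective
  have : Nontrivial B := Ideal.Quotient.nontrivial_iff.2 fun h =>
    not_subsingleton F (Module.annihilator_eq_top_iff.1 h)
  have : Algebra.FiniteType A B :=
    Algebra.FiniteType.of_surjective (φ.comp π) (hφ.comp hπ)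
  obtain ⟨s, hs, hV⟩ := exists_length_pow_le (A := A) B fun a ha => by
    change φ (algebraMap A G a) = 0
    exact Ideal.Quotient.eq_zero_iff_mem.2 (hm a ha)
  let V : Submodule A B := 1 ⊔ LinearMap.range ((φ.comp π).toLinearMap ∘ₗ reesMonomial I 1)
  have hVfg : V.FG := by
    refine Submodule.FG.sup ?_ (Module.Finite.iff_fg.1 inferInstance)
    exact ⟨{1}, by simp [Submodule.one_eq_span]⟩
  obtain ⟨C, hC⟩ := hV V hVfg
  refine ⟨s, (⊤ : Submodule A N).spanFinrank * C, ?_, fun n => ?_⟩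
  · rwa [Module.supportDim_eq_ringKrullDim_quotient_annihilator]
  · refine (sum_spanFinrank_le (φ.comp π) q hq hker (V := V)
      (Submodule.one_le.1 le_sup_left) (fun a => Submodule.mem_sup_right ⟨a, rfl⟩) n).trans ?_
    rw [Nat.cast_mul, mul_assoc]
    gcongr
    exact hC n

/-- Surjectivity lifts every element of `𝔪X` to `𝔪E`; two lifts differ by an element of the kernel
of `q`, which lies in `𝔪E`. -/
theorem mem_map_smul_top_of_apply_mem {A S G E X : Type*} [CommRing A] [CommRing S] [CommRing G]
    [Algebra A S] [Algebra A G] [AddCommGroup E] [Module S E] [AddCommGroup X] [Module G X]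
    (π : S →ₐ[A] G) (hπ : Function.Surjective π) (q : E →+ X) (hq : ∀ s e, q (s • e) = π s • q e)
    (hq' : Function.Surjective q) (m : Ideal A)
    (hker : ∀ e, q e = 0 → e ∈ (m.map (algebraMap A S) • ⊤ : Submodule S E)) {e : E}
    (he : q e ∈ (m.map (algebraMap A G) • ⊤ : Submodule G X)) :
    e ∈ (m.map (algebraMap A S) • ⊤ : Submodule S E) := by
  set K := (m.map (algebraMap A S) • ⊤ : Submodule S E) with hK
  have hlift : ∀ y ∈ (m.map (algebraMap A G) • ⊤ : Submodule G X), ∃ f ∈ K, q f = y := by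
    intro y hy
    refine Submodule.smul_induction_on hy (fun r hr y _ => ?_) fun x y hx hy => ?_
    · obtain ⟨f, rfl⟩ := hq' y
      have hr' : r ∈ (m.map (algebraMap A S)).map π := by
        rwa [← Ideal.map_coe, Ideal.map_map, AlgHom.comp_algebraMap]
      obtain ⟨s, hs, rfl⟩ := (Ideal.mem_map_iff_of_surjective π hπ).1 hr'
      exact ⟨s • f, Submodule.smul_mem_smul hs trivial, hq s f⟩
    · obtain ⟨f, hf, rfl⟩ := hx
      obtain ⟨g, hg, rfl⟩ := hy
      exact ⟨f + g, K.add_mem hf hg, map_add q f g⟩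
  obtain ⟨f, hf, hfe⟩ := hlift _ he
  have := K.add_mem (hker (e - f) (by rw [map_sub, hfe, sub_self])) hf
  rwa [sub_add_cancel] at this

theorem finite_of_surjective_of_smul_eq {S G E X : Type*} [CommRing S] [CommRing G]
    [AddCommGroup E] [Module S E] [AddCommGroup X] [Module G X] [Module.Finite S E]
    (π : S →+* G) (hπ : Function.Surjective π) (q : E →+ X) (hq : ∀ s e, q (s • e) = π s • q e)
    (hq' : Function.Surjective q) : Module.Finite G X := by
  have : RingHomSurjective π := ⟨hπ⟩
  let q' : E →ₛₗ[π] X := { q with map_smul' := hq }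
  exact Module.Finite.of_surjective q' hq'

theorem exists_sum_spanFinrank_le_of_quotient [Nontrivial N] {I : Ideal A}
    (hI : I ≤ maximalIdeal A) {G X : Type*} [CommRing G] [Algebra A G] [AddCommGroup X]
    [Module G X] (π : reesAlgebra I →ₐ[A] G) (hπ : Function.Surjective π)
    (q : (I.stableFiltration (⊤ : Submodule A N)).submodule →+ X)
    (hq : ∀ s e, q (s • e) = π s • q e) (hq' : Function.Surjective q)
    (hker : ∀ e, q e = 0 → e ∈ (I.map (algebraMap A (reesAlgebra I)) • ⊤ :
      Submodule (reesAlgebra I) (I.stableFiltration (⊤ : Submodule A N)).submodule)) :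
    ∃ s C : ℕ, (s : WithBot ℕ∞) ≤ Module.supportDim G
      (X ⧸ ((maximalIdeal A).map (algebraMap A G) • ⊤ : Submodule G X)) ∧ ∀ n : ℕ,
      ∑ i ∈ Finset.range n, ((I ^ i • ⊤ : Submodule A N).spanFinrank : ℕ∞) ≤ C * (n + 1) ^ s := by
  set Q := ((maximalIdeal A).map (algebraMap A G) • ⊤ : Submodule G X) with hQ
  let q₁ : (I.stableFiltration (⊤ : Submodule A N)).submodule →+ X ⧸ Q :=
    Q.mkQ.toAddMonoidHom.comp q
  have hq₁ : ∀ s e, q₁ (s • e) = π s • q₁ e := fun s e => by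
    change Q.mkQ (q (s • e)) = π s • Q.mkQ (q e)
    rw [hq, map_smul]
  have hq₁' : Function.Surjective q₁ := Q.mkQ_surjective.comp hq'
  have hker' : ∀ e, q₁ e = 0 → ∀ i, (e : PolynomialModule A N).coeff i ∈
      maximalIdeal A • I ^ i • (⊤ : Submodule A N) := by
    intro e he
    have h1 : q e ∈ Q := (Submodule.Quotient.mk_eq_zero Q).1 he
    have h2 := mem_map_smul_top_of_apply_mem π hπ q hq hq' (maximalIdeal A)
      (fun e he => Submodule.smul_mono_left (Ideal.map_mono hI) (hker e he)) h1
    let L : I.Filtration N :=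
      { N := fun i => maximalIdeal A • I ^ i • (⊤ : Submodule A N)
        mono := fun i => smul_mono_right _ ((I.stableFiltration ⊤).mono i)
        smul_le := fun i => by
          rw [smul_comm I]
          exact smul_mono_right _ ((I.stableFiltration ⊤).smul_le i) }
    have h3 := map_smul_filtration_submodule_le (m := maximalIdeal A)
      (F := I.stableFiltration (⊤ : Submodule A N)) (G := L) fun i => le_rfl
    have h4 := Submodule.mem_map_of_mem
      (f := (I.stableFiltration (⊤ : Submodule A N)).submodule.subtype) h2
    rw [Submodule.map_smul'', Submodule.map_top, Submodule.range_subtype] at h4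
    exact h3 h4
  have : Module.Finite (reesAlgebra I) (I.stableFiltration (⊤ : Submodule A N)).submodule :=
    Module.Finite.iff_fg.2 (stableFiltration_submodule_fg I _)
  have : Module.Finite G (X ⧸ Q) :=
    finite_of_surjective_of_smul_eq (π : reesAlgebra I →+* G) hπ q₁ hq₁ hq₁'
  -- Otherwise the degree 0 part gives `N = 𝔪N`, against Nakayama.
  have : Nontrivial (X ⧸ Q) := by
    by_contra h
    have := not_nontrivial_iff_subsingleton.1 h
    have htop : (⊤ : Submodule A N) ≤ maximalIdeal A • ⊤ := fun x _ => by
      have := hker' ⟨PolynomialModule.single A 0 x, single_mem_filtration_submodule.2 (by simp)⟩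
        (Subsingleton.elim _ _) 0
      simpa using this
    exact top_ne_bot (Submodule.eq_bot_of_le_smul_of_le_jacobson_bot _ _
      (IsNoetherian.noetherian (⊤ : Submodule A N)) htop (maximalIdeal_le_jacobson _))
  refine exists_sum_spanFinrank_le_supportDim (fun a ha => ?_) π hπ q₁ hq₁ hker'
  rw [Module.mem_annihilator]
  intro x
  obtain ⟨x, rfl⟩ := Q.mkQ_surjective x
  rw [← map_smul, Submodule.mkQ_apply, Submodule.Quotient.mk_eq_zero]
  exact Submodule.smul_mem_smul (Ideal.mem_map_of_mem _ ha) trivial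

/-- If `N ≠ 0`, then the numbers of generators of the `IⁱN` for `i < n` sum up to at most a
polynomial in `n` whose degree is at most the analytic spread. -/
theorem exists_sum_spanFinrank_le_localAnalyticSpread [Nontrivial N] {I : Ideal A}
    (hI : I ≤ maximalIdeal A) :
    ∃ s C : ℕ, (s : WithBot ℕ∞) ≤ localAnalyticSpread I N ∧ ∀ n : ℕ,
      ∑ i ∈ Finset.range n, ((I ^ i • ⊤ : Submodule A N).spanFinrank : ℕ∞) ≤ C * (n + 1) ^ s := by
  let π : reesAlgebra I →ₐ[A] AssociatedGradedRing I :=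
    Ideal.Quotient.mkₐ A (I.map (algebraMap A (reesAlgebra I)))
  let Q : Submodule (reesAlgebra I) (ReesModule I N) := I.map (algebraMap A (reesAlgebra I)) • ⊤
  let q : (I.stableFiltration (⊤ : Submodule A N)).submodule →+ AssociatedGradedModule I N :=
    Q.mkQ.toAddMonoidHom
  exact exists_sum_spanFinrank_le_of_quotient hI π Ideal.Quotient.mk_surjective q
    (fun _ _ => rfl) Q.mkQ_surjective fun e he => (Submodule.Quotient.mk_eq_zero Q).1 he

end AnalyticSpreadGrowth

/-! ### Dimension bounded by the growth of lengths. -/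

section DimensionBound

open IsLocalRing

variable {A : Type*} [CommRing A]

theorem relativeLength_top {N : Type*} [AddCommGroup N] [Module A N] (K : Submodule A N) :
    relativeLength K ⊤ = Module.length A (N ⧸ K) := by
  rw [relativeLength_eq_length_map, Submodule.map_top, Submodule.range_mkQ, Module.length_top]

variable [IsNoetherianRing A]

/-- Artin-Rees for the cyclic submodule `Ax`: `Iⁿ⁺ᶜN ∩ Ax ≤ Iⁿx`. -/
theorem exists_sub_smul_eq_zero_of_smul_mem {N : Type*} [AddCommGroup N] [Module A N]
    [Module.Finite A N] (I : Ideal A) (x : N) :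
    ∃ c : ℕ, ∀ n, ∀ a : A, a • x ∈ I ^ (n + c) • (⊤ : Submodule A N) →
      ∃ b ∈ I ^ n, (a - b) • x = 0 := by
  obtain ⟨c, hc⟩ := I.exists_pow_inf_eq_pow_smul (Submodule.span A {x})
  refine ⟨c, fun n a ha => ?_⟩
  have h1 : a • x ∈ I ^ (n + c) • ⊤ ⊓ Submodule.span A {x} :=
    ⟨ha, Submodule.smul_mem _ _ (Submodule.mem_span_singleton_self x)⟩
  rw [hc (n + c) (by lia), Nat.add_sub_cancel] at h1
  obtain ⟨b, hb, h2⟩ := Submodule.mem_smul_span_singleton.1 ((smul_mono_right (I ^ n) inf_le_right :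
    I ^ n • (I ^ c • ⊤ ⊓ Submodule.span A {x}) ≤ I ^ n • Submodule.span A {x}) h1)
  exact ⟨b, hb, by rw [sub_smul, h2, sub_self]⟩

variable {I : Ideal A}

/-- In `A/(p + Iⁿ⁺ᶜ)` the submodule generated by `x` is `A/((p + Iⁿ⁺ᶜ) : x)`. As `x` is a
nonzerodivisor modulo `p`, Artin-Rees puts this colon ideal inside `p + Iⁿ`. -/
theorem exists_length_add_le (p : Ideal A) [p.IsPrime] {x : A} (hx : x ∉ p) :
    ∃ c : ℕ, ∀ n, Module.length A (A ⧸ p ⊔ Ideal.span {x} ⊔ I ^ (n + c)) +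
      Module.length A (A ⧸ p ⊔ I ^ n) ≤ Module.length A (A ⧸ p ⊔ I ^ (n + c)) := by
  obtain ⟨c, hc⟩ := exists_sub_smul_eq_zero_of_smul_mem I (Submodule.Quotient.mk x : A ⧸ p)
  refine ⟨c, fun n => ?_⟩
  set K := p ⊔ I ^ (n + c) with hK
  have hle : K ≤ p ⊔ Ideal.span {x} ⊔ I ^ (n + c) := sup_le_sup_right le_sup_left _
  have h1 : relativeLength K (p ⊔ Ideal.span {x} ⊔ I ^ (n + c)) =
      relativeLength (Submodule.comap (LinearMap.lsmul A A x) K) ⊤ := by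
    rw [← top_inf_eq (Submodule.comap _ K), relativeLength_comap]
    congr 1
    have : (⊤ : Submodule A A).map (LinearMap.lsmul A A x) = Ideal.span {x} := by
      ext y
      simp [Ideal.mem_span_singleton', mul_comm x]
    rw [this, hK, sup_right_comm, sup_comm]
  have h2 : Submodule.comap (LinearMap.lsmul A A x) K ≤ p ⊔ I ^ n := by
    intro a ha
    obtain ⟨y, hy, z, hz, hyz⟩ := Submodule.mem_sup.1 (Submodule.mem_comap.1 ha)
    have hzx : a • (Submodule.Quotient.mk x : A ⧸ p) = Submodule.Quotient.mk z := by
      rw [← Submodule.Quotient.mk_smul, Submodule.Quotient.eq]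
      have : a • x = y + z := by rw [hyz, LinearMap.lsmul_apply, smul_eq_mul, smul_eq_mul, mul_comm]
      rwa [this, add_sub_cancel_right]
    obtain ⟨b, hb, hab⟩ := hc n a (by
      have : (Submodule.Quotient.mk z : A ⧸ p) = z • Submodule.Quotient.mk 1 := by
        rw [← Submodule.Quotient.mk_smul, smul_eq_mul, mul_one]
      rw [hzx, this]
      exact Submodule.smul_mem_smul hz trivial)
    rw [← Submodule.Quotient.mk_smul, Submodule.Quotient.mk_eq_zero, smul_eq_mul] at hab
    have hab' := (Ideal.IsPrime.mem_or_mem inferInstance hab).resolve_right hx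
    simpa using Submodule.add_mem_sup hab' hb
  rw [← relativeLength_top, ← relativeLength_top, ← relativeLength_top,
    relativeLength_eq_add hle le_top, h1, add_comm]
  gcongr
  exact relativeLength_anti h2

/-- Cutting by `x` lowers the degree of growth by one: iterate `exists_length_add_le` `n + 1` times.
The factor `n + 1` is kept on the left so that `d = 0` is covered. -/
theorem exists_length_sup_span_le (p : Ideal A) [p.IsPrime] {x : A} (hx : x ∉ p) {C d : ℕ}
    (h : ∀ n : ℕ, Module.length A (A ⧸ p ⊔ I ^ n) ≤ C * (n + 1) ^ d) :
    ∃ C' : ℕ, ∀ n : ℕ, (n + 1) * Module.length A (A ⧸ p ⊔ Ideal.span {x} ⊔ I ^ n) ≤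
      C' * (n + 1) ^ d := by
  obtain ⟨c, hc⟩ := exists_length_add_le (I := I) p hx
  have hmono : Monotone fun n => Module.length A (A ⧸ p ⊔ Ideal.span {x} ⊔ I ^ n) := fun k l hkl =>
    Module.length_le_of_surjective (Submodule.factor (sup_le_sup_left (Ideal.pow_le_pow_right hkl) _))
      (Submodule.factor_surjective _)
  have key : ∀ n j : ℕ, j * Module.length A (A ⧸ p ⊔ Ideal.span {x} ⊔ I ^ n) ≤
      Module.length A (A ⧸ p ⊔ I ^ (n + j * c)) := by
    intro n j
    induction j with
    | zero => simp
    | succ j ih =>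
      have e : n + (j + 1) * c = n + j * c + c := by ring
      rw [Nat.cast_add, Nat.cast_one, add_mul, one_mul, e, add_comm]
      exact (add_le_add (hmono (by lia)) ih).trans (hc (n + j * c))
  -- `n + (n + 1) * c + 1 = (n + 1) * (c + 1)`.
  refine ⟨C * (c + 1) ^ d, fun n => ?_⟩
  have h1 := (key n (n + 1)).trans (h _)
  refine le_trans (by exact_mod_cast h1) (le_of_eq ?_)
  push_cast
  rw [mul_assoc, ← mul_pow]
  congr 2
  ring

variable [IsLocalRing A]

/-- For a prime `y` strictly above `p`, cut by some `x ∈ y \ p`: the growth for `y` has degree one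
less. If `d = 0`, the nonzero quotients `A/(p + (x) + Iⁿ)` contradict the bound for large `n`, so no
such `y` exists. -/
theorem coheight_le_of_length_le (hI : I ≤ maximalIdeal A) (d : ℕ) :
    ∀ (p : PrimeSpectrum A) (C : ℕ),
    (∀ n : ℕ, Module.length A (A ⧸ p.asIdeal ⊔ I ^ n) ≤ C * (n + 1) ^ d) →
    Order.coheight p ≤ d := by
  induction d with
  | zero =>
    intro p C h
    rw [Order.coheight_le_coe_iff]
    intro y hy
    exfalso
    obtain ⟨x, hxy, hx⟩ := Set.exists_of_ssubset hy
    obtain ⟨C', hC'⟩ := exists_length_sup_span_le p.asIdeal hx h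
    have h1 := hC' (C' + 1)
    have h2 : Module.length A (A ⧸ p.asIdeal ⊔ Ideal.span {x} ⊔ I ^ (C' + 1)) ≠ 0 := by
      rw [Ne, Module.length_eq_zero_iff, Ideal.Quotient.subsingleton_iff]
      intro htop
      refine (IsLocalRing.maximalIdeal.isMaximal A).ne_top (top_le_iff.1 (htop ▸ ?_))
      exact sup_le (sup_le (le_maximalIdeal p.2.ne_top) ((Ideal.span_singleton_le_iff_mem _).2
        (le_maximalIdeal y.2.ne_top hxy))) ((Ideal.pow_le_self (by lia)).trans hI)
    rw [pow_zero, mul_one] at h1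
    have h3 := (le_mul_of_one_le_right (zero_le) (Order.one_le_iff_ne_zero.2 h2)).trans h1
    have h4 : C' + 1 + 1 ≤ C' := by exact_mod_cast h3
    lia
  | succ d ih =>
    intro p C h
    rw [Order.coheight_le_coe_iff]
    intro y hy
    obtain ⟨x, hxy, hx⟩ := Set.exists_of_ssubset hy
    obtain ⟨C', hC'⟩ := exists_length_sup_span_le p.asIdeal hx h
    have h1 := ih y C' fun n => by
      have h2 := hC' n
      rw [pow_succ', mul_left_comm] at h2
      have h3 : ((n : ℕ∞) + 1) ≠ 0 := by simp
      have h4 : ((n : ℕ∞) + 1) ≠ ⊤ := by exact_mod_cast ENat.natCast_ne_top (n + 1)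
      refine le_trans ?_ ((ENat.mul_le_mul_left_iff h3 h4).1 h2)
      have hle : p.asIdeal ⊔ Ideal.span {x} ⊔ I ^ n ≤ y.asIdeal ⊔ I ^ n :=
        sup_le_sup_right (sup_le hy.le ((Ideal.span_singleton_le_iff_mem _).2 hxy)) _
      exact Module.length_le_of_surjective (Submodule.factor hle) (Submodule.factor_surjective hle)
    exact lt_of_le_of_lt h1 (by exact_mod_cast Nat.lt_succ_self d)

/-- A chain in the support starts above a minimal prime `q` of the annihilator, and `q = Ann x` for
some `x`. By Artin-Rees `A/(q + Iⁿ)` is a quotient of the image of `Ax` in `N/Iⁿ⁺ᶜN`, so the bound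
passes to `q`. -/
theorem supportDim_le_of_length_le (hI : I ≤ maximalIdeal A) {N : Type*} [AddCommGroup N]
    [Module A N] [Module.Finite A N] {C d : ℕ}
    (h : ∀ n : ℕ, Module.length A (N ⧸ (I ^ n • ⊤ : Submodule A N)) ≤ C * (n + 1) ^ d) :
    Module.supportDim A N ≤ d := by
  refine iSup_le fun l => ?_
  obtain ⟨q, hq, hql⟩ := Ideal.exists_minimalPrimes_le
    (Module.mem_support_iff_of_finite.1 l.head.2)
  have hqA := Module.associatedPrimes.minimalPrimes_annihilator_subset_associatedPrimes A N hq
  obtain ⟨hqp, x, hx⟩ := isAssociatedPrime_iff.1 hqA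
  obtain ⟨c, hc⟩ := exists_sub_smul_eq_zero_of_smul_mem I x
  have hco : Order.coheight (⟨q, hqp⟩ : PrimeSpectrum A) ≤ d := by
    refine coheight_le_of_length_le hI d _ (C * (c + 1) ^ d) fun n => ?_
    let φ : A →ₗ[A] N ⧸ (I ^ (n + c) • ⊤ : Submodule A N) :=
      (Submodule.mkQ _) ∘ₗ LinearMap.toSpanSingleton A N x
    have hφ : LinearMap.ker φ ≤ q ⊔ I ^ n := by
      intro a ha
      obtain ⟨b, hb, hab⟩ := hc n a ((Submodule.Quotient.mk_eq_zero _).1 ha)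
      have : a - b ∈ q := by
        rw [hx]
        exact Submodule.mem_colon_singleton.2 hab
      simpa using Submodule.add_mem_sup this hb
    calc Module.length A (A ⧸ q ⊔ I ^ n)
        ≤ Module.length A (A ⧸ LinearMap.ker φ) :=
          Module.length_le_of_surjective (Submodule.factor hφ) (Submodule.factor_surjective hφ)
      _ = Module.length A (LinearMap.range φ) := φ.quotKerEquivRange.length_eq
      _ ≤ Module.length A (N ⧸ (I ^ (n + c) • ⊤ : Submodule A N)) :=
          Module.length_le_of_injective (Submodule.subtype _) (Submodule.subtype_injective _)
      _ ≤ C * ((n + c : ℕ) + 1) ^ d := h _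
      _ ≤ _ := by
          have : C * (n + c + 1) ^ d ≤ C * (c + 1) ^ d * (n + 1) ^ d := by
            rw [mul_assoc, ← mul_pow]
            gcongr
            nlinarith
          exact_mod_cast this
  have h1 : (l.length : ℕ∞) ≤ Order.coheight (⟨q, hqp⟩ : PrimeSpectrum A) := by
    refine (Order.length_le_coheight_head (p := l)).trans ?_
    refine (Order.coheight_le_coheight_apply_of_strictMono
      (fun z : Module.support A N => (z : PrimeSpectrum A)) (fun _ _ h => h) _).trans ?_
    exact Order.coheight_anti hql
  exact_mod_cast h1.trans hco

end DimensionBound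

/-! ### Irreducible components and socles. -/

section IrreducibleSubmodules

variable {R : Type*} [CommRing R] {M : Type*} [AddCommGroup M] [Module R M]

/-- Every nonzero submodule of `M/Q` contains an element with annihilator `p`. -/
def IsPrimeOfIrreducible (Q : Submodule R M) (p : Ideal R) : Prop :=
  ∀ x ∉ Q, ∃ a : R, a • x ∉ Q ∧ ∀ r, r • a • x ∈ Q ↔ r ∈ p

/-- In `M/Q` any two nonzero submodules meet nontrivially, in particular the cyclic ones generated
by `x` and `y`. -/
theorem exists_smul_sub_smul_mem {Q : Submodule R M} (hQ : InfIrred Q) {x y : M} (hx : x ∉ Q)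
    (hy : y ∉ Q) : ∃ a b : R, a • x ∉ Q ∧ a • x - b • y ∈ Q := by
  by_contra! h
  have key : (Q ⊔ Submodule.span R {x}) ⊓ (Q ⊔ Submodule.span R {y}) = Q := by
    refine le_antisymm ?_ (le_inf le_sup_left le_sup_left)
    rintro z ⟨hz1, hz2⟩
    obtain ⟨q1, hq1, _, hx1, rfl⟩ := Submodule.mem_sup.1 hz1
    obtain ⟨q2, hq2, _, hy2, e⟩ := Submodule.mem_sup.1 hz2
    obtain ⟨a, rfl⟩ := Submodule.mem_span_singleton.1 hx1
    obtain ⟨b, rfl⟩ := Submodule.mem_span_singleton.1 hy2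
    refine Q.add_mem hq1 (by_contra fun hax => h a b hax ?_)
    have : a • x - b • y = q2 - q1 := by
      rw [sub_eq_sub_iff_add_eq_add, e, add_comm]
    exact this ▸ Q.sub_mem hq2 hq1
  have hmem : ∀ z : M, Q ⊔ Submodule.span R {z} = Q → z ∈ Q := fun z hz =>
    hz ▸ Submodule.mem_sup_right (Submodule.mem_span_singleton_self z)
  rcases hQ.2 key with h | h
  · exact hx (hmem x h)
  · exact hy (hmem y h)

/-- Take `w` in `M/Q` with prime annihilator `p`. Every nonzero `x` shares a nonzero multiple with
`w`, and nonzero multiples of `w` all have annihilator `p`. -/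
theorem exists_isPrimeOfIrreducible [IsNoetherianRing R] {Q : Submodule R M} (hQ : InfIrred Q) :
    ∃ p : PrimeSpectrum R, IsPrimeOfIrreducible Q p.asIdeal := by
  have hne : Q ≠ ⊤ := fun h => hQ.1 (h ▸ isMax_top)
  have : Nontrivial (M ⧸ Q) := Submodule.Quotient.nontrivial_iff.2 hne
  obtain ⟨p, hp⟩ := associatedPrimes.nonempty R (M ⧸ Q)
  obtain ⟨hp, w, hw⟩ := isAssociatedPrime_iff.1 hp
  obtain ⟨w, rfl⟩ := Q.mkQ_surjective w
  have hw' : ∀ r, r • w ∈ Q ↔ r ∈ p := fun r => by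
    rw [hw, Submodule.mem_colon_singleton, ← map_smul, Submodule.mem_bot, Submodule.mkQ_apply,
      Submodule.Quotient.mk_eq_zero]
  have hwQ : w ∉ Q := fun h => hp.ne_top ((Ideal.eq_top_iff_one _).2 ((hw' 1).1 (by rwa [one_smul])))
  refine ⟨⟨p, hp⟩, fun x hx => ?_⟩
  obtain ⟨a, b, ha, hab⟩ := exists_smul_sub_smul_mem hQ hx hwQ
  have hmem : ∀ r, r • a • x ∈ Q ↔ r • b • w ∈ Q := fun r => by
    have := Q.smul_mem r hab
    rw [smul_sub] at this
    exact ⟨fun h => by simpa using Q.sub_mem h this, fun h => by simpa using Q.add_mem this h⟩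
  have hb : b ∉ p := fun hb => ha (by
    have := (hmem 1).2
    rw [one_smul, one_smul] at this
    exact this ((hw' b).2 hb))
  refine ⟨a, ha, fun r => ?_⟩
  rw [hmem, smul_smul, hw']
  exact ⟨fun h => (hp.mem_or_mem h).resolve_right hb, fun h => Ideal.mul_mem_right _ _ h⟩

/-- A component with prime `p` has no socle at another prime `p'`: an element with annihilator
exactly `p'` would pass it on to its nonzero multiples, one of which has annihilator `p`. -/
theorem IsPrimeOfIrreducible.exists_smul_mem {Q : Submodule R M} {p p' : Ideal R} [p'.IsPrime]
    (h : IsPrimeOfIrreducible Q p) (hne : p ≠ p') {x : M} (hx : x ∈ socleModulo p' Q) :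
    ∃ s ∉ p', s • x ∈ Q := by
  by_contra! hs
  have hxQ : x ∉ Q := fun hx => hs 1 (fun h1 =>
    Ideal.IsPrime.ne_top ‹_› ((Ideal.eq_top_iff_one _).2 h1)) (by rwa [one_smul])
  have hiff : ∀ r, r • x ∈ Q ↔ r ∈ p' := fun r => ⟨fun h => by_contra fun hr => hs r hr h, hx r⟩
  obtain ⟨a, ha, hap⟩ := h x hxQ
  have ha' : a ∉ p' := fun h => ha ((hiff a).2 h)
  apply hne
  ext r
  rw [← hap, smul_smul, hiff]
  exact ⟨fun h => (Ideal.IsPrime.mem_or_mem ‹_› h).resolve_right ha',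
    fun h => Ideal.mul_mem_right _ _ h⟩

/-- At its own prime an irreducible component has a one-dimensional socle. -/
theorem exists_smul_sub_smul_mem_of_mem_socleModulo {Q : Submodule R M} (hQ : InfIrred Q)
    {p : Ideal R} [p.IsPrime] {x u : M} (hu : ∀ r, r • u ∈ Q ↔ r ∈ p)
    (hx : x ∈ socleModulo p Q) : ∃ s ∉ p, ∃ a : R, s • x - a • u ∈ Q := by
  have h1 : (1 : R) ∉ p := fun h1 => Ideal.IsPrime.ne_top ‹_› ((Ideal.eq_top_iff_one _).2 h1)
  by_cases hxQ : x ∈ Q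
  · exact ⟨1, h1, 0, by simpa using hxQ⟩
  · have huQ : u ∉ Q := fun h => h1 ((hu 1).1 (by rwa [one_smul]))
    obtain ⟨a, b, ha, hab⟩ := exists_smul_sub_smul_mem hQ hxQ huQ
    exact ⟨a, fun h => ha (hx a h), b, hab⟩

/-- Elements `u i` of `K : p` that form a basis of `(K : p)/K` after localization at `p`. -/
structure IsSocleBasis (p : Ideal R) (K : Submodule R M) {ι : Type*} [Fintype ι] (u : ι → M) :
    Prop where
  mem : ∀ i, u i ∈ socleModulo p K
  indep : ∀ a : ι → R, ∑ i, a i • u i ∈ K → ∀ i, a i ∈ p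
  span : ∀ x ∈ socleModulo p K, ∃ s ∉ p, ∃ a : ι → R, s • x - ∑ i, a i • u i ∈ K

-- Irredundance yields, for each `Q`, an element outside `Q` that lies in all other components; a
-- multiple `u Q` has annihilator `P Q` modulo `Q`. As `M/K` embeds in the sum of the `M/Q`, whose
-- socles at `p` have dimension 1 or 0, the `u Q` with `P Q = p` form a basis.
open Classical in
theorem IsIrredundantIrreducibleDecomposition.exists_isSocleBasis {K : Submodule R M}
    {s : Finset (Submodule R M)} (hs : IsIrredundantIrreducibleDecomposition K s)
    {P : Submodule R M → PrimeSpectrum R}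
    (hP : ∀ Q ∈ s, IsPrimeOfIrreducible Q (P Q).asIdeal) (p : PrimeSpectrum R) :
    ∃ u : ↥(s.filter fun Q => P Q = p) → M, IsSocleBasis p.asIdeal K u := by
  have hK : ∀ x, x ∈ K ↔ ∀ Q ∈ s, x ∈ Q := fun x => by
    rw [← hs.inf_eq]
    simp
  have hu : ∀ Q ∈ s, ∃ u : M, (∀ r, r • u ∈ Q ↔ r ∈ (P Q).asIdeal) ∧ ∀ Q' ∈ s, Q' ≠ Q → u ∈ Q' := by
    intro Q hQ
    obtain ⟨x, hx, hxQ⟩ : ∃ x, (∀ Q' ∈ s, Q' ≠ Q → x ∈ Q') ∧ x ∉ Q := by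
      by_contra! h
      refine hs.irredundant (s.erase Q) (Finset.erase_ssubset hQ) ?_
      ext x
      rw [hK]
      simp only [Submodule.mem_finsetInf, Finset.mem_erase, id]
      refine ⟨fun hx Q' hQ' => ?_, fun hx Q' hQ' => hx Q' hQ'.2⟩
      by_cases e : Q' = Q
      · rw [e]
        exact h x fun Q' hQ' hne => hx Q' ⟨hne, hQ'⟩
      · exact hx Q' ⟨e, hQ'⟩
    obtain ⟨a, ha, hap⟩ := hP Q hQ x hxQ
    exact ⟨a • x, hap, fun Q' hQ' hne => Q'.smul_mem _ (hx Q' hQ' hne)⟩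
  choose! u hu hu' using hu
  have hT : ∀ i : ↥(s.filter fun Q => P Q = p), i.1 ∈ s ∧ P i.1 = p := fun i =>
    Finset.mem_filter.1 i.2
  refine ⟨fun i => u i.1, ?_, ?_, ?_⟩
  · intro i r hr
    rw [hK]
    intro Q hQ
    by_cases e : Q = i.1
    · rw [e]
      exact (hu _ (hT i).1 r).2 (by rwa [(hT i).2])
    · exact Q.smul_mem _ (hu' _ (hT i).1 Q hQ e)
  · intro a ha i
    have h1 := (hK _).1 ha i.1 (hT i).1
    rw [← Finset.add_sum_erase _ _ (Finset.mem_univ i)] at h1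
    have h2 : ∑ j ∈ Finset.univ.erase i, a j • u j.1 ∈ i.1 :=
      Submodule.sum_mem _ fun j hj => Submodule.smul_mem _ _ (hu' _ (hT j).1 _ (hT i).1
        fun e => Finset.ne_of_mem_erase hj (Subtype.ext e.symm))
    have h3 := (hu _ (hT i).1 (a i)).1 (by simpa using Submodule.sub_mem _ h1 h2)
    rwa [(hT i).2] at h3
  · intro x hx
    have hx' : ∀ Q ∈ s, x ∈ socleModulo p.asIdeal Q := fun Q hQ r hr => (hK _).1 (hx r hr) Q hQ
    have key : ∀ Q ∈ s, ∃ c ∉ p.asIdeal, ∃ a : R, (P Q ≠ p → a = 0) ∧ c • x - a • u Q ∈ Q := by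
      intro Q hQ
      by_cases e : P Q = p
      · obtain ⟨c, hc, a, h⟩ := exists_smul_sub_smul_mem_of_mem_socleModulo (hs.infIrred Q hQ)
          (fun r => by rw [← e]; exact hu Q hQ r) (hx' Q hQ)
        exact ⟨c, hc, a, fun h => absurd e h, h⟩
      · obtain ⟨c, hc, h⟩ := (hP Q hQ).exists_smul_mem
          (fun h => e (PrimeSpectrum.ext h)) (hx' Q hQ)
        exact ⟨c, hc, 0, fun _ => rfl, by simpa using h⟩
    choose! c hc a ha hca using key
    have hprod : ∀ t ⊆ s, ∏ Q ∈ t, c Q ∉ p.asIdeal := fun t ht h => by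
      obtain ⟨Q, hQ, h⟩ := (Ideal.IsPrime.prod_mem_iff).1 h
      exact hc Q (ht hQ) h
    -- The product of the `c Q` is a common denominator, and each coefficient absorbs the other
    -- factors.
    refine ⟨∏ Q ∈ s, c Q, hprod s subset_rfl,
      fun i => (∏ Q ∈ s.erase i.1, c Q) * a i.1, ?_⟩
    rw [hK]
    intro Q hQ
    have h1 : (∏ Q' ∈ s, c Q') • x - ((∏ Q' ∈ s.erase Q, c Q') * a Q) • u Q ∈ Q := by
      rw [← Finset.prod_erase_mul s c hQ, mul_smul, mul_smul, ← smul_sub]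
      exact Q.smul_mem _ (hca Q hQ)
    by_cases e : P Q = p
    · let i : ↥(s.filter fun Q => P Q = p) := ⟨Q, Finset.mem_filter.2 ⟨hQ, e⟩⟩
      rw [← Finset.add_sum_erase _ _ (Finset.mem_univ i), ← sub_sub]
      refine Q.sub_mem h1 (Submodule.sum_mem _ fun j hj => Submodule.smul_mem _ _ ?_)
      exact hu' _ (hT j).1 _ hQ fun e => Finset.ne_of_mem_erase hj (Subtype.ext e.symm)
    · rw [ha Q hQ e, mul_zero, zero_smul, sub_zero] at h1
      refine Q.sub_mem h1 (Submodule.sum_mem _ fun j hj => Submodule.smul_mem _ _ ?_)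
      exact hu' _ (hT j).1 _ hQ fun h => e (h ▸ (hT j).2)

end IrreducibleSubmodules

/-! ### The index of reducibility as a sum of local socle lengths. -/

section LocalizedSocle

variable {R : Type*} [CommRing R] {M : Type*} [AddCommGroup M] [Module R M]

/-- The length of the socle of `(M/K)_𝔭`. -/
noncomputable def socleLengthAt (p : PrimeSpectrum R) (K : Submodule R M) : ℕ∞ :=
  relativeLength (K.localized p.asIdeal.primeCompl)
    (socleModulo (IsLocalRing.maximalIdeal (Localization.AtPrime p.asIdeal))
      (K.localized p.asIdeal.primeCompl))

theorem mkLinearMap_mem_localized {p : Ideal R} [p.IsPrime] {K : Submodule R M} {x : M} :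
    LocalizedModule.mkLinearMap p.primeCompl M x ∈ K.localized p.primeCompl ↔
      ∃ s ∉ p, s • x ∈ K := by
  rw [Submodule.mem_localized']
  constructor
  · rintro ⟨m, hm, s, h⟩
    rw [IsLocalizedModule.mk'_eq_iff, Submonoid.smul_def, ← map_smul,
      IsLocalizedModule.eq_iff_exists p.primeCompl] at h
    obtain ⟨c, hc⟩ := h
    refine ⟨c * s, (c * s).2, ?_⟩
    rw [mul_smul]
    simp only [Submonoid.smul_def] at hc
    rw [← hc]
    exact K.smul_mem _ hm
  · rintro ⟨s, hs, h⟩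
    exact ⟨s • x, h, ⟨s, hs⟩, by
      rw [IsLocalizedModule.mk'_eq_iff, Submonoid.smul_def, map_smul]⟩

theorem smul_mem_localized_iff {p : Ideal R} [p.IsPrime]
    {K : Submodule (Localization.AtPrime p) (LocalizedModule p.primeCompl M)} {s : R} (hs : s ∉ p)
    {y : LocalizedModule p.primeCompl M} : s • y ∈ K ↔ y ∈ K := by
  rw [← algebraMap_smul (Localization.AtPrime p) s y]
  exact K.smul_mem_iff_of_isUnit (IsLocalization.map_units _ (⟨s, hs⟩ : p.primeCompl))

theorem mem_socleModulo_maximalIdeal {p : Ideal R} [p.IsPrime]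
    {K : Submodule (Localization.AtPrime p) (LocalizedModule p.primeCompl M)}
    {y : LocalizedModule p.primeCompl M} :
    y ∈ socleModulo (IsLocalRing.maximalIdeal (Localization.AtPrime p)) K ↔
      ∀ r ∈ p, r • y ∈ K := by
  rw [← Localization.AtPrime.map_eq_maximalIdeal, Ideal.map, mem_socleModulo_span]
  simp

/-- Only finitely many generators of `p` need a denominator, so their product works. -/
theorem exists_smul_mem_socleModulo {p : Ideal R} [p.IsPrime] (hp : p.FG) {K : Submodule R M}
    {x : M} (hx : LocalizedModule.mkLinearMap p.primeCompl M x ∈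
      socleModulo (IsLocalRing.maximalIdeal (Localization.AtPrime p)) (K.localized p.primeCompl)) :
    ∃ s ∉ p, s • x ∈ socleModulo p K := by
  classical
  rw [mem_socleModulo_maximalIdeal] at hx
  simp_rw [← map_smul, mkLinearMap_mem_localized] at hx
  choose! s hs hsx using hx
  obtain ⟨G, hG⟩ := hp
  have hGp : ∀ g ∈ G, g ∈ p := fun g hg => hG ▸ Ideal.subset_span hg
  refine ⟨∏ g ∈ G, s g, fun h => ?_, ?_⟩
  · obtain ⟨g, hg, h⟩ := (Ideal.IsPrime.prod_mem_iff).1 h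
    exact hs g (hGp g hg) h
  · rw [← hG, mem_socleModulo_span]
    intro g hg
    rw [← Finset.prod_erase_mul G s hg, mul_smul, smul_comm g, smul_comm g]
    exact K.smul_mem _ (hsx g (hGp g hg))

/-- The images of the `u i` define a map from `ι → A` onto the socle of `(M/K)_p` with kernel `ι →
m`; the socle is therefore `ι → A ⧸ m`. -/
theorem IsSocleBasis.socleLengthAt_eq [IsNoetherianRing R] {p : PrimeSpectrum R}
    {K : Submodule R M} {ι : Type*} [Fintype ι] {u : ι → M} (hu : IsSocleBasis p.asIdeal K u) :
    socleLengthAt p K = Fintype.card ι := by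
  classical
  let A := Localization.AtPrime p.asIdeal
  let f := LocalizedModule.mkLinearMap p.asIdeal.primeCompl M
  let K' := K.localized p.asIdeal.primeCompl
  let m := IsLocalRing.maximalIdeal A
  let φ : (ι → A) →ₗ[A] LocalizedModule p.asIdeal.primeCompl M :=
    Fintype.linearCombination A fun i => f (u i)
  have hφ : ∀ a : ι → R, φ (fun i => algebraMap R A (a i)) = f (∑ i, a i • u i) := fun a => by
    simp [φ, Fintype.linearCombination_apply]
  have hmem : ∀ {x}, x ∈ K → f x ∈ K' := fun {x} hx =>
    mkLinearMap_mem_localized.2 ⟨1, p.2.one_notMem, by rwa [one_smul]⟩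
  have hfu : ∀ i, f (u i) ∈ socleModulo m K' := fun i =>
    mem_socleModulo_maximalIdeal.2 fun r hr => by
      rw [← map_smul]
      exact hmem (hu.mem i r hr)
  have hker : ∀ e, φ e ∈ K' ↔ ∀ i, e i ∈ m := by
    intro e
    refine ⟨fun h i => ?_, fun h => ?_⟩
    · obtain ⟨b, hb⟩ := IsLocalization.exist_integer_multiples_of_finite p.asIdeal.primeCompl e
      choose a ha using hb
      have h1 : f (∑ i, a i • u i) ∈ K' := by
        rw [← hφ, show (fun i => algebraMap R A (a i)) = (b : R) • e from funext ha]
        rw [← algebraMap_smul A (b : R) e, map_smul]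
        exact K'.smul_mem _ h
      obtain ⟨s, hs, h2⟩ := mkLinearMap_mem_localized.1 h1
      rw [Finset.smul_sum] at h2
      simp_rw [smul_smul] at h2
      have h3 : a i ∈ p.asIdeal := (p.2.mem_or_mem (hu.indep _ h2 i)).resolve_left hs
      have h4 : algebraMap R A (a i) ∈ m := by
        change _ ∈ IsLocalRing.maximalIdeal (Localization.AtPrime p.asIdeal)
        rw [← Localization.AtPrime.map_eq_maximalIdeal]
        exact Ideal.mem_map_of_mem _ h3
      rw [ha, Algebra.smul_def] at h4
      exact (Ideal.unit_mul_mem_iff_mem _ (IsLocalization.map_units A b)).1 h4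
    · rw [Fintype.linearCombination_apply]
      exact Submodule.sum_mem _ fun i _ => hfu i _ (h i)
  have hrange : (socleModulo m K').map K'.mkQ = LinearMap.range (K'.mkQ ∘ₗ φ) := by
    apply le_antisymm
    · rintro _ ⟨y, hy, rfl⟩
      obtain ⟨⟨x, s⟩, hxs⟩ := IsLocalizedModule.surj p.asIdeal.primeCompl f y
      have hx : f x ∈ socleModulo m K' := by
        rw [← hxs]
        exact (smul_mem_localized_iff s.2).2 hy
      obtain ⟨t, ht, htx⟩ := exists_smul_mem_socleModulo (IsNoetherian.noetherian _) hx
      obtain ⟨c, hc, a, h⟩ := hu.span _ htx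
      have h1 := hmem h
      have hunit : IsUnit (algebraMap R A (c * t * s)) := IsLocalization.map_units A
        (⟨c * t * s, p.asIdeal.primeCompl.mul_mem (p.asIdeal.primeCompl.mul_mem hc ht) s.2⟩ :
          p.asIdeal.primeCompl)
      rw [← Submodule.smul_mem_iff_of_isUnit _ hunit, ← map_smul]
      refine ⟨fun i => algebraMap R A (a i), ?_⟩
      rw [LinearMap.comp_apply, hφ, eq_comm, ← sub_eq_zero, ← map_sub, Submodule.mkQ_apply,
        Submodule.Quotient.mk_eq_zero]
      convert h1 using 1
      rw [map_sub, map_smul, map_smul, ← hxs, algebraMap_smul, Submonoid.smul_def, smul_smul,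
        smul_smul]
    · rintro _ ⟨e, rfl⟩
      refine ⟨φ e, ?_, rfl⟩
      rw [Fintype.linearCombination_apply]
      exact Submodule.sum_mem _ fun i _ => Submodule.smul_mem _ _ (hfu i)
  have hker' : LinearMap.ker (K'.mkQ ∘ₗ φ) = Submodule.pi Set.univ fun _ => m := by
    ext e
    rw [LinearMap.mem_ker, LinearMap.comp_apply, Submodule.mkQ_apply,
      Submodule.Quotient.mk_eq_zero, hker]
    simp
  change relativeLength K' (socleModulo m K') = _
  rw [relativeLength_eq_length_map, hrange, ← (LinearMap.quotKerEquivRange _).length_eq, hker',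
    (Submodule.quotientPi _).length_eq, Module.length_pi_of_fintype]
  have h1 : Module.length A (A ⧸ m) = 1 := length_quotient_maximalIdeal
  exact (Finset.sum_congr rfl fun _ _ => h1).trans (by simp)

theorem IsSocleBasis.mem_associatedPrimes [IsNoetherianRing R] {p : Ideal R} (hp : p.IsPrime)
    {K : Submodule R M} {ι : Type*} [Fintype ι] {u : ι → M} (hu : IsSocleBasis p K u) (i : ι) :
    p ∈ associatedPrimes R (M ⧸ K) := by
  classical
  refine isAssociatedPrime_iff.2 ⟨hp, K.mkQ (u i), ?_⟩
  ext r
  rw [Submodule.mem_colon_singleton, ← map_smul, Submodule.mem_bot, Submodule.mkQ_apply,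
    Submodule.Quotient.mk_eq_zero]
  refine ⟨hu.mem i r, fun h => ?_⟩
  simpa using hu.indep (Pi.single i r) (by simpa [Pi.single_apply] using h) i

theorem mem_associatedPrimes_of_socleLengthAt_ne_zero [IsNoetherianRing R] [Module.Finite R M]
    {p : PrimeSpectrum R} {K : Submodule R M} (h : socleLengthAt p K ≠ 0) :
    p.asIdeal ∈ associatedPrimes R (M ⧸ K) := by
  classical
  obtain ⟨s, hs⟩ := exists_isIrredundantIrreducibleDecomposition K
  have : Nonempty (PrimeSpectrum R) := ⟨p⟩
  choose! P hP using fun Q hQ => exists_isPrimeOfIrreducible (hs.infIrred Q hQ)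
  obtain ⟨u, hu⟩ := hs.exists_isSocleBasis hP p
  rw [hu.socleLengthAt_eq, Nat.cast_ne_zero] at h
  obtain ⟨i⟩ := Fintype.card_pos_iff.1 (Nat.pos_of_ne_zero h)
  exact hu.mem_associatedPrimes p.2 i

/-- Group the components by their primes. Primes outside `Ass(M/K)` contribute 0, so one `T` can be
used for all powers of `I`. -/
theorem indexOfReducibility_eq_sum_socleLengthAt [IsNoetherianRing R] [Module.Finite R M]
    (K : Submodule R M) (T : Finset (PrimeSpectrum R))
    (hT : ∀ p : PrimeSpectrum R, p.asIdeal ∈ associatedPrimes R (M ⧸ K) → p ∈ T) :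
    (indexOfReducibility K : ℕ∞) = ∑ p ∈ T, socleLengthAt p K := by
  classical
  obtain ⟨s, hs⟩ := exists_isIrredundantIrreducibleDecomposition K
  rcases s.eq_empty_or_nonempty with rfl | ⟨Q₀, hQ₀⟩
  -- Without components there may be no prime at all (`R` may be zero), so the total function `P` is
  -- chosen only after this case.
  · have hK : K = ⊤ := by simpa using hs.inf_eq.symm
    have hzero : ∀ p : PrimeSpectrum R, socleLengthAt p K = 0 := fun p => by
      by_contra h
      have : Subsingleton (M ⧸ K) := Submodule.Quotient.subsingleton_iff.2 hK
      exact not_isAssociatedPrime_of_subsingleton (mem_associatedPrimes_of_socleLengthAt_ne_zero h)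
    simp [indexOfReducibility_eq_card hs, hzero]
  have : Nonempty (PrimeSpectrum R) := ⟨(exists_isPrimeOfIrreducible (hs.infIrred Q₀ hQ₀)).choose⟩
  choose! P hP using fun Q hQ => exists_isPrimeOfIrreducible (hs.infIrred Q hQ)
  choose u hu using hs.exists_isSocleBasis hP
  rw [indexOfReducibility_eq_card hs, Finset.card_eq_sum_card_fiberwise (f := P) (t := T),
    Nat.cast_sum]
  · refine Finset.sum_congr rfl fun p _ => ?_
    rw [(hu p).socleLengthAt_eq, Fintype.card_coe]
  · intro Q hQ
    exact hT _ ((hu (P Q)).mem_associatedPrimes (P Q).2 ⟨Q, Finset.mem_filter.2 ⟨hQ, rfl⟩⟩)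

end LocalizedSocle

/-! ### Finiteness of the associated primes of all `M/IⁿM`. -/

section AssociatedPrimes

/-- If `R → S` is a ring homomorphism with `S` Noetherian, then every prime of `R` that is the
annihilator of an element of an `S`-module is the contraction of an associated prime over `S`. -/
theorem exists_comap_eq_of_annihilator {R S W : Type*} [CommRing R] [CommRing S] [Algebra R S]
    [IsNoetherianRing S] [AddCommGroup W] [Module S W] {p : Ideal R} (hp : p.IsPrime) {w : W}
    (hw : ∀ r, algebraMap R S r • w = 0 ↔ r ∈ p) :
    ∃ q ∈ associatedPrimes S W, q.comap (algebraMap R S) = p := by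
  classical
  -- The annihilator of `b • w` after inverting `R \ p`. A maximal proper one is prime; being
  -- finitely generated, it is the annihilator of a suitable multiple of `b • w` in `W` itself.
  let q (b : S) : Ideal S :=
    { carrier := {s | ∃ t ∉ p, (algebraMap R S t * s * b) • w = 0}
      zero_mem' := ⟨1, hp.one_notMem, by simp⟩
      add_mem' := by
        rintro s s' ⟨t, ht, h⟩ ⟨t', ht', h'⟩
        refine ⟨t * t', fun h => (hp.mem_or_mem h).elim ht ht', ?_⟩
        have : algebraMap R S (t * t') * (s + s') * b =
            algebraMap R S t' * (algebraMap R S t * s * b) +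
              algebraMap R S t * (algebraMap R S t' * s' * b) := by
          rw [map_mul]
          ring
        rw [this, add_smul, mul_smul (algebraMap R S t'), mul_smul (algebraMap R S t), h, h', smul_zero,
          smul_zero, add_zero]
      smul_mem' := by
        rintro c s ⟨t, ht, h⟩
        refine ⟨t, ht, ?_⟩
        have : algebraMap R S t * (c • s) * b = c * (algebraMap R S t * s * b) := by
          rw [smul_eq_mul]
          ring
        rw [this, mul_smul, h, smul_zero] }
  have hmem : ∀ b s, s ∈ q b ↔ ∃ t ∉ p, (algebraMap R S t * s * b) • w = 0 := fun _ _ => Iff.rfl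
  obtain ⟨_, ⟨⟨b, hb, rfl⟩, hmax⟩⟩ := set_has_maximal_iff_noetherian.2
    (inferInstanceAs (IsNoetherian S S)) {J | ∃ b, 1 ∉ q b ∧ q b = J} ⟨q 1, 1, by
      rw [hmem]
      rintro ⟨t, ht, h⟩
      rw [mul_one, mul_one] at h
      exact ht ((hw t).1 h), rfl⟩
  have hprime : (q b).IsPrime := by
    refine ⟨fun h => hb (h ▸ Submodule.mem_top), fun {x y} hxy => ?_⟩
    by_contra! hcon
    obtain ⟨hx, hy⟩ := hcon
    have h1 : 1 ∉ q (x * b) := fun ⟨t, ht, h⟩ => hx ⟨t, ht, by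
      rwa [mul_one, ← mul_assoc] at h⟩
    refine hmax (q (x * b)) ⟨_, h1, rfl⟩ (lt_of_le_of_ne ?_ ?_)
    · rintro s ⟨t, ht, h⟩
      refine ⟨t, ht, ?_⟩
      rw [show algebraMap R S t * s * (x * b) = x * (algebraMap R S t * s * b) by ring, mul_smul, h,
        smul_zero]
    · intro h
      apply hy
      rw [h]
      obtain ⟨t, ht, h⟩ := hxy
      exact ⟨t, ht, by rwa [show algebraMap R S t * y * (x * b) = algebraMap R S t * (x * y) * b by
        ring]⟩
  obtain ⟨G, hG⟩ := IsNoetherian.noetherian (q b)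
  have hGq : ∀ g ∈ G, g ∈ q b := fun g hg => hG ▸ Submodule.subset_span hg
  choose! t ht htg using fun g hg => (hmem b g).1 (hGq g hg)
  have hT : ∏ g ∈ G, t g ∉ p := fun h => by
    obtain ⟨g, hg, h⟩ := hp.prod_mem_iff.1 h
    exact ht g hg h
  refine ⟨q b, isAssociatedPrime_iff.2 ⟨hprime, (algebraMap R S (∏ g ∈ G, t g) * b) • w, ?_⟩, ?_⟩
  · refine le_antisymm ?_ fun s hs => ?_
    · conv_lhs => rw [← hG]
      rw [Submodule.span_le]
      intro g hg
      rw [SetLike.mem_coe, Submodule.mem_colon_singleton, Submodule.mem_bot, smul_smul,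
        ← Finset.prod_erase_mul G t hg, map_mul,
        show ∀ a c : S, g * (a * c * b) = a * (c * g * b) by intros; ring, mul_smul, htg g hg,
        smul_zero]
    · rw [Submodule.mem_colon_singleton, Submodule.mem_bot, smul_smul] at hs
      exact ⟨_, hT, by rwa [show ∀ a : S, a * s * b = s * (a * b) by intros; ring]⟩
  · ext r
    rw [Ideal.mem_comap]
    constructor
    · rintro ⟨t, ht, h⟩
      by_contra hr
      rw [← map_mul] at h
      exact hb ⟨t * r, fun h => (hp.mem_or_mem h).elim ht hr, by rwa [mul_one]⟩
    · intro hr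
      refine ⟨1, hp.one_notMem, ?_⟩
      rw [map_one, one_mul, mul_comm, mul_smul, (hw r).2 hr, smul_zero]

theorem finite_setOf_annihilator {R S W : Type*} [CommRing R] [CommRing S] [Algebra R S]
    [IsNoetherianRing S] [AddCommGroup W] [Module S W] {E : Submodule S W} (hE : E.FG)
    (K : Submodule S W) :
    {p : PrimeSpectrum R | ∃ w ∈ E, ∀ r, algebraMap R S r • w ∈ K ↔ r ∈ p.asIdeal}.Finite := by
  have : Module.Finite S (E.map K.mkQ) := Module.Finite.iff_fg.2 (hE.map _)
  have hfin : ((fun q : Ideal S => q.comap (algebraMap R S)) ''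
      associatedPrimes S (E.map K.mkQ)).Finite := (associatedPrimes.finite _ _).image _
  refine (hfin.preimage (f := PrimeSpectrum.asIdeal) fun p _ q _ h => PrimeSpectrum.ext h).subset ?_
  rintro p ⟨w, hwE, hw⟩
  refine exists_comap_eq_of_annihilator p.2 (w := ⟨K.mkQ w, Submodule.mem_map_of_mem hwE⟩)
    fun r => ?_
  rw [← hw, ← Submodule.coe_eq_zero, Submodule.coe_smul, ← map_smul, Submodule.mkQ_apply,
    Submodule.Quotient.mk_eq_zero]

variable {R : Type*} [CommRing R] {M : Type*} [AddCommGroup M] [Module R M]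

/-- If some `r • x` reaches `F (k + 1)` outside `F n`, it has the same annihilator modulo `F n` and
replaces `x`. Otherwise `x` has the same annihilator modulo `F (k + 1)` as modulo `F n`. -/
theorem exists_annihilator_of_antitone {p : Ideal R} (hp : p.IsPrime) {F : ℕ → Submodule R M}
    (hF : Antitone F) (n : ℕ) : ∀ j k, k + j = n → ∀ x ∈ F k, (∀ r : R, r • x ∈ F n ↔ r ∈ p) →
      ∃ k, ∃ x ∈ F k, ∀ r : R, r • x ∈ F (k + 1) ↔ r ∈ p := by
  intro j
  induction j with
  | zero =>
    rintro k rfl x hx h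
    exact absurd ((h 1).1 (by rwa [one_smul])) hp.one_notMem
  | succ j ih =>
    intro k hk x hx h
    by_cases hc : ∃ r : R, r • x ∈ F (k + 1) ∧ r • x ∉ F n
    · obtain ⟨r, hr, hr'⟩ := hc
      rw [h] at hr'
      refine ih (k + 1) (by lia) (r • x) hr fun c => ?_
      rw [smul_smul, h]
      exact ⟨fun h => (hp.mem_or_mem h).resolve_right hr', fun h => Ideal.mul_mem_right _ _ h⟩
    · push Not at hc
      exact ⟨k, x, hx, fun r => ⟨fun hr => (h r).1 (hc r hr), fun hr =>
        hF (by lia : k + 1 ≤ n) ((h r).2 hr)⟩⟩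

/-- Each such prime is the annihilator of a homogeneous element of `⨁ IᵏM/Iᵏ⁺¹M`, hence contracted
from one of the finitely many associated primes of this module over the Rees algebra. -/
theorem exists_finset_associatedPrimes [IsNoetherianRing R] [Module.Finite R M] (I : Ideal R) :
    ∃ T : Finset (PrimeSpectrum R), ∀ (n : ℕ) (p : PrimeSpectrum R),
      p.asIdeal ∈ associatedPrimes R (M ⧸ (I ^ n • ⊤ : Submodule R M)) → p ∈ T := by
  let F := I.stableFiltration (⊤ : Submodule R M)
  let K := (shiftFiltration 1 F).submodule
  have hfin := finite_setOf_annihilator (R := R) (stableFiltration_submodule_fg I (⊤ : Submodule R M)) K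
  refine ⟨hfin.toFinset, fun n p hp => ?_⟩
  rw [Set.Finite.mem_toFinset]
  obtain ⟨-, y, hy⟩ := isAssociatedPrime_iff.1 hp
  obtain ⟨y, rfl⟩ := Submodule.mkQ_surjective _ y
  obtain ⟨k, x, hx, h⟩ := exists_annihilator_of_antitone p.2
    (F := fun n => (I ^ n • ⊤ : Submodule R M))
    (fun a b hab => Submodule.smul_mono_left (Ideal.pow_le_pow_right hab)) n n 0 (zero_add n) y
    (by simp) fun r => by
      rw [hy, Submodule.mem_colon_singleton, ← map_smul, Submodule.mem_bot, Submodule.mkQ_apply,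
        Submodule.Quotient.mk_eq_zero]
  refine ⟨PolynomialModule.single R k x, single_mem_filtration_submodule.2 hx, fun r => ?_⟩
  rw [algebraMap_smul, ← h r, ← PolynomialModule.single_smul, single_mem_filtration_submodule]
  rfl

end AssociatedPrimes

/-! ### Degree bounds over a local ring. -/

section LocalBounds

open IsLocalRing

theorem EventuallyEval.exists_forall_le_mul_pow {P : ℚ[X]} {f : ℕ → ℕ∞} (h : EventuallyEval P f)
    (hf : ∀ n, f n ≠ ⊤) : ∃ C : ℕ, ∀ n : ℕ, f n ≤ C * (n + 1) ^ P.natDegree := by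
  obtain ⟨C, hC⟩ := h.exists_le_mul_pow
  obtain ⟨n₀, hC⟩ := eventually_atTop.1 hC
  choose g hg using fun n => ENat.ne_top_iff_exists.1 (hf n)
  refine ⟨C + ∑ k ∈ Finset.range n₀, g k, fun n => ?_⟩
  rcases le_or_gt n₀ n with hn | hn
  · refine (hC n hn).trans ?_
    gcongr
    exact_mod_cast Nat.le_add_right _ _
  · rw [← hg]
    have h1 : g n ≤ ∑ k ∈ Finset.range n₀, g k :=
      Finset.single_le_sum (fun _ _ => Nat.zero_le _) (Finset.mem_range.2 hn)
    have h2 : g n ≤ (C + ∑ k ∈ Finset.range n₀, g k) * (n + 1) ^ P.natDegree :=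
      (h1.trans (Nat.le_add_left _ _)).trans (Nat.le_mul_of_pos_right _ (by positivity))
    exact_mod_cast h2

variable {A : Type*} [CommRing A] {N : Type*} [AddCommGroup N] [Module A N] {I : Ideal A}

theorem length_quotient_pow_smul_top (I : Ideal A) (n : ℕ) :
    Module.length A (N ⧸ (I ^ n • ⊤ : Submodule A N)) =
      ∑ k ∈ Finset.range n, relativeLength (I ^ (k + 1) • ⊤) (I ^ k • ⊤ : Submodule A N) := by
  rw [← relativeLength_top]
  induction n with
  | zero => simp [relativeLength_eq_zero_iff]
  | succ n ih =>
    rw [relativeLength_eq_add (Submodule.smul_mono_left (Ideal.pow_le_pow_right n.le_succ)) le_top,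
      ih, Finset.sum_range_succ, add_comm]

theorem pow_mul_smul_top_le {m : Ideal A} {s : ℕ} (h : m ^ s • (⊤ : Submodule A N) ≤ I • ⊤)
    (n : ℕ) : m ^ (s * n) • (⊤ : Submodule A N) ≤ I ^ n • ⊤ := by
  induction n with
  | zero => simp
  | succ n ih =>
    calc m ^ (s * (n + 1)) • (⊤ : Submodule A N) = m ^ s • m ^ (s * n) • ⊤ := by
          rw [← Submodule.mul_smul, ← pow_add, Nat.mul_succ, add_comm]
      _ ≤ m ^ s • I ^ n • ⊤ := smul_mono_right _ ih
      _ = I ^ n • m ^ s • ⊤ := by rw [← Submodule.mul_smul, ← Submodule.mul_smul, mul_comm]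
      _ ≤ I ^ n • I • ⊤ := smul_mono_right _ h
      _ = I ^ (n + 1) • ⊤ := by rw [← Submodule.mul_smul, pow_succ]

variable [IsNoetherianRing A] [IsLocalRing A] [Module.Finite A N] {P : ℚ[X]}

/-- The case where `N/IN` has finite length. -/
theorem supportDim_le_natDegree_add_one [Nontrivial N] (hI : I ≤ maximalIdeal A) {s : ℕ}
    (hs : maximalIdeal A ^ s • (⊤ : Submodule A N) ≤ I • ⊤)
    (hP : EventuallyEval P fun n =>
      relativeLength (I ^ n • ⊤) (socleModulo (maximalIdeal A) (I ^ n • ⊤ : Submodule A N))) :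
    P ≠ 0 ∧ Module.supportDim A N ≤ (P.natDegree + 1 : ℕ) := by
  constructor
  -- A zero socle would force `N = IⁿN`, against Nakayama.
  · refine hP.ne_zero ((eventually_ge_atTop 1).mono fun n hn h => ?_)
    obtain ⟨C, hC⟩ := exists_relativeLength_le_mul_socle (A := A) (N := N) (s * n)
    have h1 := hC _ ⊤ le_top (pow_mul_smul_top_le hs n)
    rw [h, mul_zero, nonpos_iff_eq_zero, relativeLength_eq_zero_iff] at h1
    have h2 : (⊤ : Submodule A N) ≤ maximalIdeal A • ⊤ :=
      h1.trans (Submodule.smul_mono_left ((Ideal.pow_le_self (by lia)).trans hI))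
    have h3 := Submodule.eq_bot_of_le_smul_of_le_jacobson_bot _ _ (Module.Finite.fg_top) h2
      (maximalIdeal_le_jacobson _)
    exact bot_ne_top h3.symm
  -- `𝔪ˢ` kills every `IᵏN/Iᵏ⁺¹N`, so the same `C` bounds all of them by socle lengths; summing over
  -- `k < n` raises the degree by one.
  · obtain ⟨C, hC⟩ := exists_relativeLength_le_mul_socle (A := A) (N := N) s
    obtain ⟨D, hD⟩ := hP.exists_forall_le_mul_pow fun n => relativeLength_socleModulo_ne_top _
    refine supportDim_le_of_length_le (C := C * D) hI fun n => ?_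
    rw [length_quotient_pow_smul_top]
    calc ∑ k ∈ Finset.range n, relativeLength (I ^ (k + 1) • ⊤) (I ^ k • ⊤ : Submodule A N)
        ≤ ∑ k ∈ Finset.range n, (C * (D * (n + 1) ^ P.natDegree) : ℕ∞) := by
          refine Finset.sum_le_sum fun k hk => ?_
          refine (hC _ (I ^ k • ⊤) (Submodule.smul_mono_left (Ideal.pow_le_pow_right k.le_succ))
            ?_).trans ?_
          · rw [pow_succ, Submodule.mul_smul, ← Submodule.mul_smul, mul_comm, Submodule.mul_smul]
            exact smul_mono_right _ hs
          · gcongr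
            refine (hD (k + 1)).trans ?_
            gcongr
            have : k + 1 ≤ n := Finset.mem_range.1 hk
            exact_mod_cast this
      _ ≤ _ := by
          have : n * (C * (D * (n + 1) ^ P.natDegree)) ≤ C * D * (n + 1) ^ (P.natDegree + 1) := by
            rw [pow_succ]
            calc n * (C * (D * (n + 1) ^ P.natDegree))
                ≤ (n + 1) * (C * (D * (n + 1) ^ P.natDegree)) := Nat.mul_le_mul_right _ n.le_succ
              _ = _ := by ring
          rw [Finset.sum_const, Finset.card_range, nsmul_eq_mul]
          exact_mod_cast this

/-- The socle length in degree `n + c` is at most `g n * B + b`. The constant `b`, due to `0 : 𝔪`,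
sums to a linear term, whence `max L 1`. -/
theorem EventuallyEval.degree_lt_of_span {L : ℕ} {g : ℕ → ℕ} {C : ℕ}
    (hP : EventuallyEval P fun n =>
      relativeLength (I ^ n • ⊤) (socleModulo (maximalIdeal A) (I ^ n • ⊤ : Submodule A N)))
    (hU : ∀ n, ∃ U : Finset N, Submodule.span A (U : Set N) = I ^ n • ⊤ ∧ U.card ≤ g n)
    (hg : ∀ n : ℕ, ∑ k ∈ Finset.range n, (g k : ℕ∞) ≤ C * (n + 1) ^ L) :
    P.degree < (max L 1 : ℕ) := by
  obtain ⟨-, c, b, D, hD, hb⟩ := exists_eventuallyEval_socle (N := N) I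
  obtain ⟨B, hB⟩ := exists_relativeLength_le_card_mul I D c hD
  have hle : ∀ n, relativeLength (I ^ (n + c) • ⊤)
      (socleModulo (maximalIdeal A) (I ^ (n + c) • ⊤ : Submodule A N)) ≤ g n * B + b := fun n => by
    obtain ⟨U, hU, hUg⟩ := hU n
    refine (hb n).trans ?_
    gcongr
    refine (hB n U hU).trans ?_
    gcongr
  have hne : ∑ k ∈ Finset.range c, relativeLength (I ^ k • ⊤)
      (socleModulo (maximalIdeal A) (I ^ k • ⊤ : Submodule A N)) ≠ ⊤ :=
    (WithTop.sum_ne_top).2 fun k _ => relativeLength_socleModulo_ne_top _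
  obtain ⟨F, hF⟩ := ENat.ne_top_iff_exists.1 hne
  refine hP.degree_lt_of_sum_le (C := F + C * B + b) fun n => ?_
  calc ∑ k ∈ Finset.range n, relativeLength (I ^ k • ⊤)
        (socleModulo (maximalIdeal A) (I ^ k • ⊤ : Submodule A N))
      ≤ ∑ k ∈ Finset.range (c + n), relativeLength (I ^ k • ⊤)
        (socleModulo (maximalIdeal A) (I ^ k • ⊤ : Submodule A N)) :=
        Finset.sum_le_sum_of_subset (Finset.range_subset_range.2 (Nat.le_add_left n c))
    _ ≤ F + ∑ k ∈ Finset.range n, (g k * B + b : ℕ∞) := by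
        rw [Finset.sum_range_add, ← hF]
        gcongr with k hk
        rw [add_comm c k]
        exact hle k
    _ ≤ F + (C * (n + 1) ^ L * B + n * b) := by
        rw [Finset.sum_add_distrib, ← Finset.sum_mul, Finset.sum_const, Finset.card_range,
          nsmul_eq_mul]
        gcongr
        exact hg n
    _ ≤ _ := by
        have h1 : (n + 1) ^ L ≤ (n + 1) ^ max L 1 := Nat.pow_le_pow_right n.succ_pos (le_max_left _ _)
        have h2 : n + 1 ≤ (n + 1) ^ max L 1 := by
          calc n + 1 = (n + 1) ^ 1 := (pow_one _).symm
            _ ≤ _ := Nat.pow_le_pow_right n.succ_pos (le_max_right _ _)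
        have : F + (C * (n + 1) ^ L * B + n * b) ≤ (F + C * B + b) * (n + 1) ^ max L 1 := by
          calc F + (C * (n + 1) ^ L * B + n * b)
              ≤ F * (n + 1) ^ max L 1 + (C * (n + 1) ^ max L 1 * B + (n + 1) ^ max L 1 * b) := by
                gcongr
                · exact Nat.le_mul_of_pos_right _ (by positivity)
                · lia
            _ = _ := by ring
        exact_mod_cast this

end LocalBounds

/-! ### Passage to the localizations. -/

section Localization

variable {R : Type*} [CommRing R] {M : Type*} [AddCommGroup M] [Module R M]

theorem localized_mono (p : Ideal R) [p.IsPrime] {K L : Submodule R M} (h : K ≤ L) :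
    K.localized p.primeCompl ≤ L.localized p.primeCompl := fun x hx => by
  obtain ⟨y, hy, s, hs⟩ := (Submodule.mem_localized' _ _ _ _ _).1 hx
  exact (Submodule.mem_localized' _ _ _ _ _).2 ⟨y, h hy, s, hs⟩

theorem localized_smul (p I : Ideal R) [p.IsPrime] (K : Submodule R M) :
    (I • K).localized p.primeCompl =
      I.map (algebraMap R (Localization.AtPrime p)) • K.localized p.primeCompl := by
  rw [Submodule.localized, Submodule.localized'_smul]
  congr 1
  rw [Submodule.localized'_eq_span]
  rfl

theorem localized_pow_smul_top (p I : Ideal R) [p.IsPrime] (n : ℕ) :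
    (I ^ n • ⊤ : Submodule R M).localized p.primeCompl =
      I.map (algebraMap R (Localization.AtPrime p)) ^ n • ⊤ := by
  rw [localized_smul, Ideal.map_pow, Submodule.localized, Submodule.localized'_top]

/-- Numerators of minimal generators at `m` lie in `K` and still generate at the smaller prime `p`.
-/
theorem exists_span_eq_localized {p m : Ideal R} [p.IsPrime] [m.IsPrime] (hpm : p ≤ m)
    {K : Submodule R M} (hK : K.FG) :
    ∃ U : Finset (LocalizedModule p.primeCompl M),
      Submodule.span (Localization.AtPrime p) (U : Set (LocalizedModule p.primeCompl M)) =
        K.localized p.primeCompl ∧ U.card ≤ (K.localized m.primeCompl).spanFinrank := by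
  classical
  have hfg : (K.localized m.primeCompl).FG := by
    obtain ⟨t, rfl⟩ := hK
    rw [Submodule.localized, Submodule.localized'_span]
    exact ⟨t.image (LocalizedModule.mkLinearMap m.primeCompl M), by rw [Finset.coe_image]⟩
  obtain ⟨V, hV, hspan⟩ := hfg.exists_span_finset_card_eq_spanFinrank
  have hVK : ∀ v ∈ V, ∃ x ∈ K, ∃ s : m.primeCompl,
      IsLocalizedModule.mk' (LocalizedModule.mkLinearMap m.primeCompl M) x s = v := fun v hv => by
    rw [← Submodule.mem_localized' (Localization.AtPrime m)]
    change v ∈ K.localized m.primeCompl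
    rw [← hspan]
    exact Submodule.subset_span hv
  choose! x hx s hs using hVK
  refine ⟨V.image fun v => LocalizedModule.mkLinearMap p.primeCompl M (x v), ?_,
    Finset.card_image_le.trans hV.le⟩
  let L := Submodule.span R (V.image x : Set M)
  have hLK : L ≤ K := Submodule.span_le.2 fun y hy => by
    obtain ⟨v, hv, rfl⟩ := Finset.mem_image.1 hy
    exact hx v hv
  have hle : K.localized m.primeCompl ≤ L.localized m.primeCompl := by
    rw [← hspan, Submodule.span_le]
    intro v hv
    exact (Submodule.mem_localized' _ _ _ _ _).2
      ⟨x v, Submodule.subset_span (Finset.mem_image_of_mem x hv), s v, hs v hv⟩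
  have hL : Submodule.span (Localization.AtPrime p)
      ((V.image fun v => LocalizedModule.mkLinearMap p.primeCompl M (x v) :
        Finset (LocalizedModule p.primeCompl M)) : Set (LocalizedModule p.primeCompl M)) =
      L.localized p.primeCompl := by
    rw [Submodule.localized, Submodule.localized'_span]
    simp only [Finset.coe_image, Set.image_image]
  rw [hL]
  refine le_antisymm (localized_mono p hLK) ?_
  rw [Submodule.localized, Submodule.localized'_eq_span, Submodule.span_le]
  rintro _ ⟨y, hy, rfl⟩
  obtain ⟨t, ht, hty⟩ := mkLinearMap_mem_localized.1
    (hle (mkLinearMap_mem_localized.2 ⟨1, (‹m.IsPrime› : m.IsPrime).one_notMem, by rwa [one_smul]⟩ :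
      LocalizedModule.mkLinearMap m.primeCompl M y ∈ K.localized m.primeCompl))
  exact mkLinearMap_mem_localized.2 ⟨t, fun h => ht (hpm h), hty⟩

theorem nontrivial_localizedModule_of_mem_associatedPrimes [IsNoetherianRing R] {p m : Ideal R}
    [m.IsPrime] (hpm : p ≤ m) {K : Submodule R M} (hp : p ∈ associatedPrimes R (M ⧸ K)) :
    Nontrivial (LocalizedModule m.primeCompl M) := by
  by_contra h
  rw [not_nontrivial_iff_subsingleton, LocalizedModule.subsingleton_iff] at h
  obtain ⟨-, y, hy⟩ := isAssociatedPrime_iff.1 hp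
  obtain ⟨y, rfl⟩ := K.mkQ_surjective y
  obtain ⟨s, hs, hsy⟩ := h y
  refine hs (hpm ?_)
  rw [hy, Submodule.mem_colon_singleton, ← map_smul, hsy, map_zero]
  exact Submodule.zero_mem _

theorem le_of_mem_associatedPrimes [IsNoetherianRing R] {I p : Ideal R} {n : ℕ}
    (hp : p ∈ associatedPrimes R (M ⧸ (I ^ n • ⊤ : Submodule R M))) : I ≤ p := by
  have := IsAssociatedPrime.isPrime hp
  refine Ideal.IsPrime.le_of_pow_le (n := n) fun r hr => ?_
  obtain ⟨-, y, hy⟩ := isAssociatedPrime_iff.1 hp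
  obtain ⟨y, rfl⟩ := Submodule.mkQ_surjective _ y
  rw [hy, Submodule.mem_colon_singleton, ← map_smul, Submodule.mem_bot, Submodule.mkQ_apply,
    Submodule.Quotient.mk_eq_zero]
  exact Submodule.smul_mem_smul hr trivial

theorem mem_minimalPrimes_annihilator_of_minimal {W : Type*} [AddCommGroup W] [Module R W]
    [IsNoetherianRing R] [Module.Finite R W] {p : Ideal R}
    (hp : Minimal (· ∈ associatedPrimes R W) p) :
    p ∈ (Module.annihilator R W).minimalPrimes := by
  have hpp : p.IsPrime := IsAssociatedPrime.isPrime hp.1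
  obtain ⟨q, hq, hqp⟩ := Ideal.exists_minimalPrimes_le (IsAssociatedPrime.annihilator_le hp.1)
  rw [Submodule.annihilator_top] at hq
  have h1 : q ∈ associatedPrimes R W :=
    Module.associatedPrimes.minimalPrimes_annihilator_subset_associatedPrimes R W hq
  rwa [← le_antisymm hqp (hp.2 h1 hqp)]

/-- `p` is minimal over the annihilator of `M/IM`, so after localization that annihilator contains a
power of the maximal ideal. -/
theorem exists_pow_maximalIdeal_smul_top_le [IsNoetherianRing R] [Module.Finite R M]
    {I p : Ideal R} [p.IsPrime]
    (hp : Minimal (· ∈ associatedPrimes R (M ⧸ (I • ⊤ : Submodule R M))) p) :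
    ∃ s, IsLocalRing.maximalIdeal (Localization.AtPrime p) ^ s •
      (⊤ : Submodule (Localization.AtPrime p) (LocalizedModule p.primeCompl M)) ≤
        I.map (algebraMap R (Localization.AtPrime p)) • ⊤ := by
  let J := Module.annihilator R (M ⧸ (I • ⊤ : Submodule R M))
  have hJ : J • (⊤ : Submodule R M) ≤ I • ⊤ := by
    rw [Submodule.smul_le]
    intro r hr x _
    have := Module.mem_annihilator.1 hr ((I • ⊤ : Submodule R M).mkQ x)
    rwa [← map_smul, Submodule.mkQ_apply, Submodule.Quotient.mk_eq_zero] at this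
  have hrad := IsLocalization.AtPrime.radical_map_of_mem_minimalPrimes
    (A := Localization.AtPrime p) p J (mem_minimalPrimes_annihilator_of_minimal hp)
  rw [Localization.AtPrime.map_eq_maximalIdeal] at hrad
  obtain ⟨s, hs⟩ := Ideal.exists_pow_le_of_le_radical_of_fg hrad.ge (IsNoetherian.noetherian _)
  refine ⟨s, (Submodule.smul_mono_left hs).trans ?_⟩
  have := localized_mono p hJ
  rwa [localized_smul, localized_smul, Submodule.localized, Submodule.localized'_top] at this

theorem map_le_maximalIdeal {I p : Ideal R} [p.IsPrime] (h : I ≤ p) :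
    I.map (algebraMap R (Localization.AtPrime p)) ≤
      IsLocalRing.maximalIdeal (Localization.AtPrime p) := by
  rw [← Localization.AtPrime.map_eq_maximalIdeal]
  exact Ideal.map_mono h

variable [IsNoetherianRing R] [Module.Finite R M]

theorem exists_eventuallyEval_socleLengthAt (M : Type*) [AddCommGroup M] [Module R M]
    [Module.Finite R M] (I : Ideal R) (p : PrimeSpectrum R) :
    ∃ P : ℚ[X], EventuallyEval P fun n => socleLengthAt p (I ^ n • ⊤ : Submodule R M) := by
  simp_rw [socleLengthAt, localized_pow_smul_top]
  exact (exists_eventuallyEval_socle _).1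

theorem mem_stableAssociatedPrimes {I : Ideal R} {p : PrimeSpectrum R} {P : ℚ[X]}
    (hP : EventuallyEval P fun n => socleLengthAt p (I ^ n • ⊤ : Submodule R M)) (h0 : P ≠ 0) :
    p.asIdeal ∈ stableAssociatedPrimes I M :=
  (hP.eventually_ne_zero h0).mono fun _ h => mem_associatedPrimes_of_socleLengthAt_ne_zero h

theorem supportDim_le_natDegree_socleLengthAt {I : Ideal R} {p : PrimeSpectrum R} {P : ℚ[X]}
    (hp : Minimal (· ∈ associatedPrimes R (M ⧸ (I • ⊤ : Submodule R M))) p.asIdeal)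
    (hP : EventuallyEval P fun n => socleLengthAt p (I ^ n • ⊤ : Submodule R M)) :
    P ≠ 0 ∧ Module.supportDim (Localization p.asIdeal.primeCompl)
      (LocalizedModule p.asIdeal.primeCompl M) ≤ (P.natDegree + 1 : ℕ) := by
  have hp1 : p.asIdeal ∈ associatedPrimes R (M ⧸ (I ^ 1 • ⊤ : Submodule R M)) := by
    rw [pow_one]
    exact hp.1
  have := nontrivial_localizedModule_of_mem_associatedPrimes le_rfl hp1
  obtain ⟨s, hs⟩ := exists_pow_maximalIdeal_smul_top_le hp
  simp_rw [socleLengthAt, localized_pow_smul_top] at hP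
  exact supportDim_le_natDegree_add_one (map_le_maximalIdeal (le_of_mem_associatedPrimes hp1)) hs hP

theorem natDegree_socleLengthAt_add_one_le {I : Ideal R} {p : PrimeSpectrum R} {P : ℚ[X]}
    (hP : EventuallyEval P fun n => socleLengthAt p (I ^ n • ⊤ : Submodule R M)) (h0 : P ≠ 0)
    (hI : analyticSpread I M ≠ 0) : ((P.natDegree + 1 : ℕ) : WithBot ℕ∞) ≤ analyticSpread I M := by
  have hstable := mem_stableAssociatedPrimes hP h0
  obtain ⟨n, hn⟩ := Eventually.exists hstable
  obtain ⟨m, hm, hpm⟩ := p.asIdeal.exists_le_maximal p.2.ne_top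
  let m' : MaximalSpectrum R := ⟨m, hm⟩
  have := hm.isPrime
  have := nontrivial_localizedModule_of_mem_associatedPrimes hpm hn
  obtain ⟨s, C, hs, hC⟩ := exists_sum_spanFinrank_le_localAnalyticSpread
    (N := LocalizedModule m.primeCompl M)
    (map_le_maximalIdeal ((le_of_mem_associatedPrimes hn).trans hpm))
  have hs' : (s : WithBot ℕ∞) ≤ analyticSpread I M :=
    hs.trans (le_iSup₂_of_le m' ⟨_, hstable, hpm⟩ le_rfl)
  simp_rw [socleLengthAt, localized_pow_smul_top] at hP
  have hdeg := hP.degree_lt_of_span (fun n => by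
    simp_rw [← localized_pow_smul_top]
    exact exists_span_eq_localized hpm (IsNoetherian.noetherian _)) hC
  rw [← natDegree_lt_iff_degree_lt h0] at hdeg
  -- The spread is at least `s`, hence not `⊥`, and it is not 0 by hypothesis.
  have h1 : (1 : WithBot ℕ∞) ≤ analyticSpread I M := by
    generalize analyticSpread I M = l at *
    induction l with
    | bot => exact absurd hs' (not_le.2 (WithBot.bot_lt_coe (s : ℕ∞)))
    | coe a => exact_mod_cast Order.one_le_iff_ne_zero.2 fun h => hI (by rw [h]; rfl)
  have h2 : ((max s 1 : ℕ) : WithBot ℕ∞) ≤ analyticSpread I M := by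
    rcases max_choice s 1 with h | h <;> rw [h]
    · exact hs'
    · exact_mod_cast h1
  exact le_trans (by exact_mod_cast hdeg) h2

theorem map_degree_add_one {P : ℚ[X]} (h : P ≠ 0) :
    P.degree.map (Nat.cast : ℕ → ℕ∞) + 1 = ((P.natDegree + 1 : ℕ) : WithBot ℕ∞) := by
  rw [degree_eq_natDegree h]
  rfl

end Localization

end ReducibilityIndex

theorem theorem4p1 {R : Type*} [CommRing R] [IsNoetherianRing R]
    {M : Type*} [AddCommGroup M] [Module R M] [Module.Finite R M] (I : Ideal R) :
    ∃ P : ℚ[X],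
      (∀ᶠ n : ℕ in atTop,
        P.eval (n : ℚ) =
          (ReducibilityIndex.indexOfReducibility (I ^ n • ⊤ : Submodule R M) : ℚ)) ∧
      ReducibilityIndex.bigHeight I M ≤ P.degree.map (Nat.cast : ℕ → ℕ∞) + 1 ∧
      (ReducibilityIndex.analyticSpread I M ≠ 0 →
        P.degree.map (Nat.cast : ℕ → ℕ∞) + 1 ≤ ReducibilityIndex.analyticSpread I M) := by
  classical
  obtain ⟨T, hT⟩ := ReducibilityIndex.exists_finset_associatedPrimes (M := M) I
  choose P hP using ReducibilityIndex.exists_eventuallyEval_socleLengthAt M I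
  have hsum := ReducibilityIndex.EventuallyEval.sum T fun p _ => hP p
  refine ⟨∑ p ∈ T, P p, ?_, ?_, fun hI => ?_⟩
  · filter_upwards [hsum] with n ⟨k, hk, hk'⟩
    rw [← ReducibilityIndex.indexOfReducibility_eq_sum_socleLengthAt _ T (hT n)] at hk
    rw [hk']
    exact_mod_cast hk.symm
  · refine iSup₂_le fun p hp => ?_
    have hpT : p ∈ T := hT 1 p (by rw [pow_one]; exact hp.1)
    obtain ⟨h0, hdim⟩ := ReducibilityIndex.supportDim_le_natDegree_socleLengthAt hp (hP p)
    -- Each socle length is at most the whole sum, so no cancellation can lower the degree.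
    have hdeg := (hP p).degree_le hsum (Eventually.of_forall fun n =>
      Finset.single_le_sum (f := fun p => ReducibilityIndex.socleLengthAt p (I ^ n • ⊤ : Submodule R M))
        (fun _ _ => zero_le) hpT)
    have h1 : ∑ p ∈ T, P p ≠ 0 := fun h => h0 (by rwa [h, degree_zero, le_bot_iff, degree_eq_bot] at hdeg)
    rw [ReducibilityIndex.map_degree_add_one h1]
    have := natDegree_le_natDegree hdeg
    exact hdim.trans (by exact_mod_cast Nat.succ_le_succ this)
  · by_cases h0 : ∑ p ∈ T, P p = 0
    · rw [h0, degree_zero]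
      exact bot_le
    rw [ReducibilityIndex.map_degree_add_one h0]
    -- The degree of a sum is at most the largest degree of its terms.
    obtain ⟨p, hp0, hdeg⟩ : ∃ p, P p ≠ 0 ∧ (∑ p ∈ T, P p).natDegree ≤ (P p).natDegree := by
      by_contra! h
      have hlt : (∑ p ∈ T, P p).degree < (∑ p ∈ T, P p).degree := by
        refine (degree_sum_le _ _).trans_lt ((Finset.sup_lt_iff ?_).2 fun p _ => ?_)
        · exact bot_lt_iff_ne_bot.2 (degree_ne_bot.2 h0)
        · by_cases hp : P p = 0
          · rw [hp, degree_zero]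
            exact bot_lt_iff_ne_bot.2 (degree_ne_bot.2 h0)
          · exact degree_lt_degree (h p hp)
      exact hlt.false
    exact le_trans (by exact_mod_cast Nat.succ_le_succ hdeg)
      (ReducibilityIndex.natDegree_socleLengthAt_add_one_le (hP p) hp0 hI)
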